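/- **Setting.** Let $(M,g)$ be a globally hyperbolic spacetime (a time-oriented Lorentzian manifold of signature $(-,+,\dots,+)$ without closed causal curves, all of whose causal diamonds $J^+(p)\cap J^-(q)$ are compact), and let $\iota:\Sigma\hookrightarrow M$ be a smooth spacelike Cauchy surface. Manifolds are smooth, Hausdorff and $\sigma$-compact; vector bundles are smooth, complex and of finite rank. A hermitian structure on a bundle $V$ is a smooth, fibrewise non-degenerate (not necessarily positive) hermitian form, and $(u|v)_V=\int (u(x),v(x))_V\,d\mathrm{Vol}$ (over $M$ with the volume of $g$, over $\Sigma$ with the volume of the induced metric). $\Gamma$, $\Gamma_{\rm c}$, $\Gamma_{\rm sc}$ denote the smooth sections, those of compact support, and those supported in $J^+(C)\cup J^-(C)$ for some compact $C\subset M$. $A^*$ is the formal adjoint of a differential operator $A$. A differential operator $D$ is *Green hyperbolic* if $D$ and $D^*$ have retarded and advanced propagators, i.e. linear maps $G^\pm:\Gamma_{\rm c}\to\Gamma$ with $DG^\pm=G^\pm D=\mathbf 1$ on $\Gamma_{\rm c}$ and $\operatorname{supp}G^\pm u\subset J^\pm(\operatorname{supp}u)$; then $G_D:=G_D^+-G_D^-$.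 Let $V_0,V_1$ be bundles with hermitian structure over $M$, and let $P\in\mathrm{Diff}(M;V_1)$, $K,T\in\mathrm{Diff}(M;V_0,V_1)$ satisfy $P^*=P$, $K\neq0$, $PK=0$, and suppose that $$R:=K^*K,\qquad D:=P+TK^*,\qquad Q:=K^*T$$ are Green hyperbolic. For $A=R,D,Q$ (acting on sections of $V_0,V_1,V_0$) let $\rho_A$ be a differential operator followed by the pullback $\iota^*$, with values in the sections of a bundle with hermitian structure $V_{\rho_A}$ over $\Sigma$, such that $A$ is *Cauchy hyperbolic* for $\rho_A$, i.e. $\rho_A:\operatorname{Ker}A|_{\Gamma_{\rm sc}}\to\Gamma_{\rm c}(\Sigma;V_{\rho_A})$ is a bijection; let $U_A$ be the inverse of this bijection. Put $$K_\Sigma:=\rho_D K U_R,\qquad K_\Sigma^\dagger:=\rho_Q K^* U_D\qquad\text{on }\Gamma_{\rm c}(\Sigma;\cdot),$$ $$\mathcal V_P:=\frac{\operatorname{Ker}K^*|_{\Gamma_{\rm c}}}{\operatorname{Ran}P|_{\Gamma_{\rm c}}},\qquad \mathcal V_{\Sigma P}:=\frac{\operatorname{Ker}K_\Sigma^\dagger|_{\Gamma_{\rm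 c}}}{\operatorname{Ran}K_\Sigma|_{\Gamma_{\rm c}}}.$$ **Proposition.** 1. $\operatorname{Ran}G_DT|_{\Gamma_{\rm c}}\subset\operatorname{Ker}D|_{\Gamma_{\rm sc}}\cap\operatorname{Ker}K^*|_{\Gamma_{\rm sc}}$ and $\operatorname{Ran}K_\Sigma|_{\Gamma_{\rm c}}\subset\operatorname{Ker}K_\Sigma^\dagger|_{\Gamma_{\rm c}}$, and the induced linear map $$[\rho_D]:\ \frac{\operatorname{Ker}D|_{\Gamma_{\rm sc}}\cap\operatorname{Ker}K^*|_{\Gamma_{\rm sc}}}{\operatorname{Ran}G_DT|_{\Gamma_{\rm c}}}\longrightarrow\frac{\operatorname{Ker}K_\Sigma^\dagger|_{\Gamma_{\rm c}}}{\operatorname{Ran}K_\Sigma|_{\Gamma_{\rm c}}}$$ is well defined and bijective. 2. $\operatorname{Ran}P|_{\Gamma_{\rm c}}\subset\operatorname{Ker}K^*|_{\Gamma_{\rm c}}$, the sesquilinear form $q_P([u],[v]):=\mathrm i^{-1}(u|G_Dv)_{V_1}$ is well defined on $\mathcal V_P$, and the induced map $[\rho_DG_D]:\mathcal V_P\to\mathcal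 V_{\Sigma P}$ is well defined, linear and bijective. Hence it is an isomorphism of $(\mathcal V_P,q_P)$ onto $(\mathcal V_{\Sigma P},q_{\Sigma P})$, where the sesquilinear form $q_{\Sigma P}$ is given by $q_{\Sigma P}([\rho_DG_Du],[\rho_DG_Dv])=q_P([u],[v])$. 3. Let $G_{D\Sigma}:\Gamma_{\rm c}(\Sigma;V_{\rho_D})\to\Gamma_{\rm c}(\Sigma;V_{\rho_D})$ be a linear operator with $(u|G_Dv)_{V_1}=(\rho_DG_Du\,|\,G_{D\Sigma}\,\rho_DG_Dv)_{V_{\rho_D}}$ for all $u,v\in\Gamma_{\rm c}(M;V_1)$ (for $D=D^*$ this is $G_D=-G_D\rho_D^*G_{D\Sigma}\rho_DG_D$). Consider the formula $$q_{\Sigma P}([\varphi],[\psi])=\mathrm i^{-1}(\varphi|G_{D\Sigma}\psi)_{V_{\rho_D}}.\tag{$*$}$$ * If $T=K$, then $(*)$ holds for all $\varphi,\psi\in\operatorname{Ker}K_\Sigma^\dagger|_{\Gamma_{\rm c}}$. * If $D=D^*$, then $(*)$ holds for all $\varphi\in\rho_DG_D\operatorname{Ker}K^*|_{\Gamma_{\rm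 c}}$ and all $\psi\in\operatorname{Ker}K_\Sigma^\dagger|_{\Gamma_{\rm c}}$; and it holds for all $\varphi,\psi\in\operatorname{Ker}K_\Sigma^\dagger|_{\Gamma_{\rm c}}$ if and only if $(u|G_Dv)_{V_1}=0$ for all $u,v\in\operatorname{Ran}T|_{\Gamma_{\rm c}}$. -/

import Mathlib

open scoped Manifold ContDiff Topology
open Bundle Set MeasureTheory

universe u v w

noncomputable section

namespace GaugeTheory

/-! ### Hermitian bundles and their sections -/

/-- Smoothness of a section of a vector bundle with model fibre `F` over an `n`-manifold. -/
def IsSmoothSection (n : ℕ) {M : Type u} [TopologicalSpace M]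
    [ChartedSpace (EuclideanSpace ℝ (Fin n)) M] (F : Type v) [NormedAddCommGroup F]
    [NormedSpace ℂ F] (V : M → Type v) [TopologicalSpace (TotalSpace F V)]
    [∀ x, TopologicalSpace (V x)] [FiberBundle F V] (s : ∀ x, V x) : Prop :=
  ContMDiff (𝓡 n) ((𝓡 n).prod 𝓘(ℝ, F)) ∞ fun x => TotalSpace.mk' F x (s x)

/-- A smooth complex vector bundle of finite rank over the `n`-manifold `M`, with a hermitian
structure: a smooth family of non-degenerate (not necessarily positive) hermitian forms on the
fibres, antilinear in the first argument. The trivialisations are complex linear (`vectorC`) and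
the transition functions are smooth over the real manifold `M` (`smooth`). -/
structure HermitianBundle (n : ℕ) (M : Type u) [TopologicalSpace M]
    [ChartedSpace (EuclideanSpace ℝ (Fin n)) M] where
  F : Type v
  V : M → Type v
  [normedF : NormedAddCommGroup F]
  [spaceF : NormedSpace ℂ F]
  [finiteF : FiniteDimensional ℂ F]
  [topTotal : TopologicalSpace (TotalSpace F V)]
  [addV : ∀ x, AddCommGroup (V x)]
  [modV : ∀ x, Module ℂ (V x)]
  [topV : ∀ x, TopologicalSpace (V x)]
  [fiber : FiberBundle F V]
  [vectorR : VectorBundle ℝ F V]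
  [vectorC : VectorBundle ℂ F V]
  [smooth : ContMDiffVectorBundle ∞ F V (𝓡 n)]
  form : ∀ x, V x →ₗ⋆[ℂ] V x →ₗ[ℂ] ℂ
  form_conj : ∀ x (a b : V x), star (form x a b) = form x b a
  form_nondeg : ∀ x (a : V x), (∀ b, form x a b = 0) → a = 0
  form_smooth : ∀ s t : ∀ x, V x, IsSmoothSection n F V s → IsSmoothSection n F V t →
    ContMDiff (𝓡 n) 𝓘(ℝ, ℂ) ∞ fun x => form x (s x) (t x)

attribute [instance] HermitianBundle.normedF HermitianBundle.spaceF HermitianBundle.finiteF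
  HermitianBundle.topTotal HermitianBundle.addV HermitianBundle.modV HermitianBundle.topV
  HermitianBundle.fiber HermitianBundle.vectorR HermitianBundle.vectorC HermitianBundle.smooth

section Sections

variable {n : ℕ} {M : Type u} [TopologicalSpace M] [ChartedSpace (EuclideanSpace ℝ (Fin n)) M]

theorem IsSmoothSection.smul {B : HermitianBundle.{u, v} n M} {s : ∀ x, B.V x}
    (hs : IsSmoothSection n B.F B.V s) (c : ℂ) : IsSmoothSection n B.F B.V (c • s) := by
  intro x₀
  have h := hs x₀
  rw [contMDiffAt_section] at h ⊢
  set e := trivializationAt B.F B.V x₀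
  have hc : ContMDiff 𝓘(ℝ, B.F) 𝓘(ℝ, B.F) ∞ fun a : B.F => c • a :=
    (contDiff_const_smul c).contMDiff
  refine ((hc _).comp x₀ h).congr_of_eventuallyEq ?_
  filter_upwards [e.open_baseSet.mem_nhds (mem_baseSet_trivializationAt B.F B.V x₀)] with x hx
  exact (e.linear ℂ hx).2 c (s x)

/-- The subspace of smooth sections among all sections. -/
def smoothSections (B : HermitianBundle.{u, v} n M) : Submodule ℂ (∀ x, B.V x) where
  carrier := {s | IsSmoothSection n B.F B.V s}
  add_mem' hs ht := ContMDiff.add_section hs ht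
  zero_mem' := contMDiff_zeroSection ℝ B.V
  smul_mem' c _ hs := IsSmoothSection.smul hs c

/-- `Γ(M; V)`: the complex vector space of smooth sections. -/
def Sec (B : HermitianBundle.{u, v} n M) : Type (max u v) := ↥(smoothSections B)

instance (B : HermitianBundle.{u, v} n M) : AddCommGroup (Sec B) :=
  inferInstanceAs (AddCommGroup ↥(smoothSections B))

instance (B : HermitianBundle.{u, v} n M) : Module ℂ (Sec B) :=
  inferInstanceAs (Module ℂ ↥(smoothSections B))

theorem Sec.zero_val {B : HermitianBundle.{u, v} n M} : (0 : Sec B).1 = 0 := rfl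

theorem Sec.add_val {B : HermitianBundle.{u, v} n M} (s t : Sec B) : (s + t).1 = s.1 + t.1 := rfl

theorem Sec.smul_val {B : HermitianBundle.{u, v} n M} (c : ℂ) (s : Sec B) :
    (c • s).1 = c • s.1 := rfl

/-- The support of a section. -/
def supp {B : HermitianBundle.{u, v} n M} (s : Sec B) : Set M := closure {x | s.1 x ≠ 0}

theorem supp_zero {B : HermitianBundle.{u, v} n M} : supp (0 : Sec B) = ∅ := by
  simp [supp, Sec.zero_val]

theorem supp_add {B : HermitianBundle.{u, v} n M} (s t : Sec B) :
    supp (s + t) ⊆ supp s ∪ supp t := by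
  unfold supp
  rw [← closure_union]
  refine closure_mono fun x hx => ?_
  by_contra h
  simp only [mem_union, mem_ofPred_eq, not_or, not_not] at h
  exact hx (by simp [Sec.add_val, h.1, h.2])

theorem supp_smul {B : HermitianBundle.{u, v} n M} (c : ℂ) (s : Sec B) :
    supp (c • s) ⊆ supp s := by
  refine closure_mono fun x hx h => hx ?_
  have h' : s.1 x = 0 := h
  simp [Sec.smul_val, h']

/-- `Γ_c(M; V)`: the smooth sections with compact support. -/
def SecC (B : HermitianBundle.{u, v} n M) : Submodule ℂ (Sec B) where
  carrier := {s | IsCompact (supp s)}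
  add_mem' {s t} hs ht := (hs.union ht).of_isClosed_subset isClosed_closure (supp_add s t)
  zero_mem' := by simp [supp_zero]
  smul_mem' c s hs := IsCompact.of_isClosed_subset hs isClosed_closure (supp_smul c s)

/-- Multiplication of sections by a smooth real function. -/
def mulFun {B : HermitianBundle.{u, v} n M} (f : C^∞⟮𝓡 n, M; ℝ⟯) : Sec B →ₗ[ℂ] Sec B where
  toFun s := ⟨fun x => (f x : ℂ) • s.1 x, by
    have h := ContMDiff.smul_section f.contMDiff s.2
    have e : (fun x => (f x : ℂ) • s.1 x) = (fun x => f x • s.1 x) := by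
      funext x; exact Complex.coe_smul _ _
    rw [e]; exact h⟩
  map_add' s t := Subtype.ext <| by
    funext x
    exact smul_add (f x : ℂ) (s.1 x) (t.1 x)
  map_smul' c s := Subtype.ext <| by
    funext x
    exact smul_comm (f x : ℂ) c (s.1 x)

end Sections

/-! ### Differential operators -/

section DiffOp

variable {n m : ℕ} {M : Type u} [TopologicalSpace M] [ChartedSpace (EuclideanSpace ℝ (Fin n)) M]
  {N : Type w} [TopologicalSpace N] [ChartedSpace (EuclideanSpace ℝ (Fin m)) N]

/-- `IsDiffOpLT ι k A`: the linear map `A` from sections over `M` to sections over `N` is a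
differential operator of order `< k` along the smooth map `ι : N → M`, by the commutator
criterion: `A = 0` for `k = 0`, and for `k + 1` all commutators `s ↦ A (f s) - (f ∘ ι) (A s)`,
`f` a smooth function on `M`, have order `< k`. For an embedding `ι` these are the
differential operators on `M` followed by the pullback `ι^*`. -/
def IsDiffOpLT (ι : C^∞⟮𝓡 m, N; 𝓡 n, M⟯) {V : HermitianBundle.{u, v} n M}
    {W : HermitianBundle.{w, v} m N} : ℕ → (Sec V →ₗ[ℂ] Sec W) → Prop
  | 0, A => A = 0
  | k + 1, A => ∀ f : C^∞⟮𝓡 n, M; ℝ⟯,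
      IsDiffOpLT ι k (A ∘ₗ mulFun f - mulFun (f.comp ι) ∘ₗ A)

/-- Differential operators (of some finite order) along `ι`. -/
def IsDiffOpAlong (ι : C^∞⟮𝓡 m, N; 𝓡 n, M⟯) {V : HermitianBundle.{u, v} n M}
    {W : HermitianBundle.{w, v} m N} (A : Sec V →ₗ[ℂ] Sec W) : Prop :=
  ∃ k, IsDiffOpLT ι k A

/-- `Diff(M; V, W)`. -/
def IsDiffOp {V W : HermitianBundle.{u, v} n M} (A : Sec V →ₗ[ℂ] Sec W) : Prop :=
  IsDiffOpAlong ContMDiffMap.id A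

end DiffOp

/-! ### Volume measure, pairing, formal adjoints -/

section Volume

variable {n : ℕ} {M : Type u} [TopologicalSpace M] [T2Space M] [SigmaCompactSpace M]
  [ChartedSpace (EuclideanSpace ℝ (Fin n)) M] [IsManifold (𝓡 n) ∞ M] [MeasurableSpace M]

/-- A smooth partition of unity subordinate to the preferred charts of `M`. -/
def chartPartition (n : ℕ) (M : Type u) [TopologicalSpace M] [T2Space M] [SigmaCompactSpace M]
    [ChartedSpace (EuclideanSpace ℝ (Fin n)) M] [IsManifold (𝓡 n) ∞ M] :
    SmoothPartitionOfUnity M (𝓡 n) M univ :=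
  (SmoothPartitionOfUnity.exists_isSubordinate_chartAt_source (𝓡 n) M).choose

/-- In the chart around `p`, the density `|det (b(∂_i, ∂_j))|^{1/2}` at the point with
coordinates `y`. -/
def volDensity (b : ∀ x : M, TangentSpace (𝓡 n) x → TangentSpace (𝓡 n) x → ℝ)
    (p : M) (y : EuclideanSpace ℝ (Fin n)) : ℝ :=
  √|Matrix.det (Matrix.of fun i j : Fin n =>
    b ((extChartAt (𝓡 n) p).symm y)
      (mfderiv (𝓡 n) (𝓡 n) (extChartAt (𝓡 n) p).symm y (EuclideanSpace.single i (1 : ℝ)))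
      (mfderiv (𝓡 n) (𝓡 n) (extChartAt (𝓡 n) p).symm y (EuclideanSpace.single j (1 : ℝ))))|

/-- The (pseudo-)Riemannian volume measure of the family of bilinear forms `b`, equal to
`|det (b(∂_i, ∂_j))|^{1/2} dy` in charts, glued by a partition of unity. -/
def volMeasure (b : ∀ x : M, TangentSpace (𝓡 n) x → TangentSpace (𝓡 n) x → ℝ) : Measure M :=
  Measure.sum fun p : M =>
    ((volume.restrict (extChartAt (𝓡 n) p).target).withDensity fun y =>
      ENNReal.ofReal (chartPartition n M p ((extChartAt (𝓡 n) p).symm y) * volDensity b p y)).map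
        (extChartAt (𝓡 n) p).symm

end Volume

section Pairing

variable {n : ℕ} {M : Type u} [TopologicalSpace M] [ChartedSpace (EuclideanSpace ℝ (Fin n)) M]
  [MeasurableSpace M]

/-- `(s|t)_V = ∫ (s(x), t(x))_V dμ`, meant for `s` or `t` of compact support. -/
def pairing (μ : Measure M) {B : HermitianBundle.{u, v} n M} (s t : Sec B) : ℂ :=
  ∫ x, B.form x (s.1 x) (t.1 x) ∂μ

/-- `A'` is the formal adjoint `A^*` of the differential operator `A`. -/
def IsFormalAdjoint (μ : Measure M) {V W : HermitianBundle.{u, v} n M}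
    (A : Sec V →ₗ[ℂ] Sec W) (A' : Sec W →ₗ[ℂ] Sec V) : Prop :=
  IsDiffOp A ∧ IsDiffOp A' ∧ ∀ s ∈ SecC V, ∀ t ∈ SecC W, pairing μ (A s) t = pairing μ s (A' t)

end Pairing

/-! ### Spacetimes and their causal structure -/

/-- A time-oriented Lorentzian metric, of signature `(-,+,…,+)`, on the `(d+1)`-manifold `M`. The
time orientation is the one of the timelike vector field `timeField`. -/
structure Spacetime (d : ℕ) (M : Type u) [TopologicalSpace M]
    [ChartedSpace (EuclideanSpace ℝ (Fin (d + 1))) M] [IsManifold (𝓡 (d + 1)) ∞ M] where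
  metric : ∀ x : M,
    TangentSpace (𝓡 (d + 1)) x →L[ℝ] TangentSpace (𝓡 (d + 1)) x →L[ℝ] ℝ
  symm : ∀ x v w, metric x v w = metric x w v
  smooth_metric : ContMDiff (𝓡 (d + 1)) ((𝓡 (d + 1)).prod
      𝓘(ℝ, EuclideanSpace ℝ (Fin (d + 1)) →L[ℝ] EuclideanSpace ℝ (Fin (d + 1)) →L[ℝ] ℝ)) ∞
    fun x => TotalSpace.mk'
      (EuclideanSpace ℝ (Fin (d + 1)) →L[ℝ] EuclideanSpace ℝ (Fin (d + 1)) →L[ℝ] ℝ)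
      (E := fun x : M => TangentSpace (𝓡 (d + 1)) x →L[ℝ] TangentSpace (𝓡 (d + 1)) x →L[ℝ] ℝ)
      x (metric x)
  lorentzian : ∀ x, ∃ v, metric x v v < 0 ∧ ∀ w, metric x v w = 0 → w ≠ 0 → 0 < metric x w w
  timeField : ∀ x : M, TangentSpace (𝓡 (d + 1)) x
  smooth_timeField : ContMDiff (𝓡 (d + 1)) (𝓡 (d + 1)).tangent ∞
    fun x => (⟨x, timeField x⟩ : TangentBundle (𝓡 (d + 1)) M)
  timelike_timeField : ∀ x, metric x (timeField x) (timeField x) < 0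

namespace Spacetime

section Causality

variable {d : ℕ} {M : Type u} [TopologicalSpace M]
  [ChartedSpace (EuclideanSpace ℝ (Fin (d + 1))) M] [IsManifold (𝓡 (d + 1)) ∞ M]
  (g : Spacetime d M)

/-- Future-directed causal tangent vectors (in particular non-zero ones). -/
def FutureCausal (x : M) (v : TangentSpace (𝓡 (d + 1)) x) : Prop :=
  g.metric x v v ≤ 0 ∧ g.metric x (g.timeField x) v < 0

/-- Future-directed timelike tangent vectors. -/
def FutureTimelike (x : M) (v : TangentSpace (𝓡 (d + 1)) x) : Prop :=
  g.metric x v v < 0 ∧ g.metric x (g.timeField x) v < 0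

/-- The velocity of a curve. -/
def velocity (γ : ℝ → M) (t : ℝ) : TangentSpace (𝓡 (d + 1)) (γ t) :=
  mfderiv 𝓘(ℝ, ℝ) (𝓡 (d + 1)) γ t (1 : ℝ)

/-- `p` and `q` are joined by a future-directed causal `C^1` curve. -/
def CausalStep (p q : M) : Prop :=
  ∃ γ : ℝ → M, ContMDiff 𝓘(ℝ, ℝ) (𝓡 (d + 1)) 1 γ ∧ γ 0 = p ∧ γ 1 = q ∧
    ∀ t ∈ Icc (0 : ℝ) 1, g.FutureCausal (γ t) (velocity γ t)

/-- `J^+(A)`: the points of `A` and those reached from `A` by a future-directed causal piecewise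
`C^1` curve. -/
def causalFuture (A : Set M) : Set M := {q | ∃ p ∈ A, Relation.ReflTransGen g.CausalStep p q}

/-- `J^-(A)`. -/
def causalPast (A : Set M) : Set M := {p | ∃ q ∈ A, Relation.ReflTransGen g.CausalStep p q}

/-- Global hyperbolicity: there are no closed causal curves, and the causal diamonds
`J^+(p) ∩ J^-(q)` are compact. -/
def GloballyHyperbolic : Prop :=
  (∀ p, ¬ Relation.TransGen g.CausalStep p p) ∧
    ∀ p q, IsCompact (g.causalFuture {p} ∩ g.causalPast {q})

/-- An inextensible future-directed timelike `C^1` curve: it has no endpoint. -/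
def InextensibleTimelike (γ : ℝ → M) : Prop :=
  ContMDiff 𝓘(ℝ, ℝ) (𝓡 (d + 1)) 1 γ ∧ (∀ t, g.FutureTimelike (γ t) (velocity γ t)) ∧
    (¬ ∃ p, Filter.Tendsto γ Filter.atTop (𝓝 p)) ∧ ¬ ∃ p, Filter.Tendsto γ Filter.atBot (𝓝 p)

/-- `Γ_sc(M; V)`: the space-compact smooth sections, i.e. those supported in
`J^+(K) ∪ J^-(K)` for some compact `K`. -/
def SecSC (B : HermitianBundle.{u, v} (d + 1) M) : Submodule ℂ (Sec B) where
  carrier := {s | ∃ K, IsCompact K ∧ supp s ⊆ g.causalFuture K ∪ g.causalPast K}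
  add_mem' := by
    rintro s t ⟨K, hK, hs⟩ ⟨L, hL, ht⟩
    refine ⟨K ∪ L, hK.union hL, (supp_add s t).trans ?_⟩
    rintro x (hx | hx)
    · rcases hs hx with ⟨p, hp, h⟩ | ⟨p, hp, h⟩
      exacts [Or.inl ⟨p, Or.inl hp, h⟩, Or.inr ⟨p, Or.inl hp, h⟩]
    · rcases ht hx with ⟨p, hp, h⟩ | ⟨p, hp, h⟩
      exacts [Or.inl ⟨p, Or.inr hp, h⟩, Or.inr ⟨p, Or.inr hp, h⟩]
  zero_mem' := ⟨∅, isCompact_empty, by simp [supp_zero]⟩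
  smul_mem' := by
    rintro c s ⟨K, hK, hs⟩
    exact ⟨K, hK, (supp_smul c s).trans hs⟩

/-- `Ker A|_{Γ_sc}`. -/
def kerSC {V W : HermitianBundle.{u, v} (d + 1) M} (A : Sec V →ₗ[ℂ] Sec W) :
    Submodule ℂ (Sec V) :=
  g.SecSC V ⊓ LinearMap.ker A

end Causality

/-! ### Green hyperbolic operators -/

section Green

variable {d : ℕ} {M : Type u} [TopologicalSpace M] [T2Space M] [SigmaCompactSpace M]
  [ChartedSpace (EuclideanSpace ℝ (Fin (d + 1))) M] [IsManifold (𝓡 (d + 1)) ∞ M]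
  [MeasurableSpace M] (g : Spacetime d M)

/-- The measure `dVol_g`. -/
def vol : Measure M := volMeasure fun x v w => g.metric x v w

/-- `G` inverts `D` from both sides on compactly supported sections. -/
def IsGreen {V : HermitianBundle.{u, v} (d + 1) M} (D : Sec V →ₗ[ℂ] Sec V)
    (G : SecC V →ₗ[ℂ] Sec V) : Prop :=
  (∀ s : SecC V, D (G s) = s) ∧ ∀ s t : SecC V, D s = t → G t = s

/-- `G` is the retarded propagator `G_D^+`. -/
def IsRetarded {V : HermitianBundle.{u, v} (d + 1) M} (D : Sec V →ₗ[ℂ] Sec V)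
    (G : SecC V →ₗ[ℂ] Sec V) : Prop :=
  IsGreen D G ∧ ∀ s : SecC V, supp (G s) ⊆ g.causalFuture (supp (s : Sec V))

/-- `G` is the advanced propagator `G_D^-`. -/
def IsAdvanced {V : HermitianBundle.{u, v} (d + 1) M} (D : Sec V →ₗ[ℂ] Sec V)
    (G : SecC V →ₗ[ℂ] Sec V) : Prop :=
  IsGreen D G ∧ ∀ s : SecC V, supp (G s) ⊆ g.causalPast (supp (s : Sec V))

/-- `D` has a retarded and an advanced propagator. -/
def HasPropagators {V : HermitianBundle.{u, v} (d + 1) M} (D : Sec V →ₗ[ℂ] Sec V) : Prop :=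
  (∃ G, g.IsRetarded D G) ∧ ∃ G, g.IsAdvanced D G

/-- `D` is Green hyperbolic: `D` and `D^*` have retarded and advanced propagators. -/
def GreenHyperbolic {V : HermitianBundle.{u, v} (d + 1) M} (D : Sec V →ₗ[ℂ] Sec V) : Prop :=
  g.HasPropagators D ∧ ∃ D', IsFormalAdjoint g.vol D D' ∧ g.HasPropagators D'

/-- The causal propagator `G_D = G_D^+ - G_D^-` of a Green hyperbolic operator (the propagators
`G_D^±` are unique). -/
def causalPropagator {V : HermitianBundle.{u, v} (d + 1) M} {D : Sec V →ₗ[ℂ] Sec V}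
    (hD : g.GreenHyperbolic D) : SecC V →ₗ[ℂ] Sec V :=
  hD.1.1.choose - hD.1.2.choose

end Green

end Spacetime

/-! ### Cauchy surfaces and Cauchy data -/

/-- A smooth spacelike Cauchy surface, as the image of an embedding `ι : S → M` of a
`d`-manifold: it is met exactly once by every inextensible timelike curve. -/
structure CauchySurface {d : ℕ} {M : Type u} [TopologicalSpace M]
    [ChartedSpace (EuclideanSpace ℝ (Fin (d + 1))) M] [IsManifold (𝓡 (d + 1)) ∞ M]
    (g : Spacetime d M) (S : Type w) [TopologicalSpace S]
    [ChartedSpace (EuclideanSpace ℝ (Fin d)) S] [IsManifold (𝓡 d) ∞ S] where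
  ι : C^∞⟮𝓡 d, S; 𝓡 (d + 1), M⟯
  embedding : Manifold.IsSmoothEmbedding (𝓡 d) (𝓡 (d + 1)) ∞ ι
  spacelike : ∀ (y : S) (v : TangentSpace (𝓡 d) y), v ≠ 0 →
    0 < g.metric (ι y) (mfderiv (𝓡 d) (𝓡 (d + 1)) ι y v) (mfderiv (𝓡 d) (𝓡 (d + 1)) ι y v)
  meets : ∀ γ, g.InextensibleTimelike γ → ∃! t, γ t ∈ range ι

namespace CauchySurface

variable {d : ℕ} {M : Type u} [TopologicalSpace M]
  [ChartedSpace (EuclideanSpace ℝ (Fin (d + 1))) M] [IsManifold (𝓡 (d + 1)) ∞ M]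
  {g : Spacetime d M} {S : Type w} [TopologicalSpace S]
  [ChartedSpace (EuclideanSpace ℝ (Fin d)) S] [IsManifold (𝓡 d) ∞ S]

/-- The induced Riemannian metric `ι^* g`. -/
def inducedMetric (C : CauchySurface g S) (y : S) (v w : TangentSpace (𝓡 d) y) : ℝ :=
  g.metric (C.ι y) (mfderiv (𝓡 d) (𝓡 (d + 1)) C.ι y v) (mfderiv (𝓡 d) (𝓡 (d + 1)) C.ι y w)

/-- The volume measure of the induced metric. -/
def vol [T2Space S] [SigmaCompactSpace S] [MeasurableSpace S] (C : CauchySurface g S) :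
    Measure S :=
  volMeasure C.inducedMetric

/-- `D` is Cauchy hyperbolic for the map `ρ`: here `ρ` is a differential operator followed by the
pullback to the Cauchy surface, and `ρ : Ker D|_{Γ_sc} → Γ_c(S; W)` is a bijection, i.e. the
Cauchy problem `D f = 0`, `ρ f = φ` has a unique solution `f` in `Γ_sc` for all `φ` in `Γ_c`. -/
structure IsCauchyHyperbolic (C : CauchySurface g S) {V : HermitianBundle.{u, v} (d + 1) M}
    {W : HermitianBundle.{w, v} d S} (D : Sec V →ₗ[ℂ] Sec V) (ρ : Sec V →ₗ[ℂ] Sec W) :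
    Prop where
  isDiffOp : IsDiffOpAlong C.ι ρ
  bijOn : BijOn ρ (g.kerSC D) (SecC W)

/-- The operator `U_D` solving the Cauchy problem: `U_D φ` is the `f` in `Ker D|_{Γ_sc}` with
`ρ f = φ`. -/
def solution {C : CauchySurface g S} {V : HermitianBundle.{u, v} (d + 1) M}
    {W : HermitianBundle.{w, v} d S} {D : Sec V →ₗ[ℂ] Sec V} {ρ : Sec V →ₗ[ℂ] Sec W}
    (h : C.IsCauchyHyperbolic D ρ) : SecC W →ₗ[ℂ] Sec V :=
  (g.kerSC D).subtype ∘ₗ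
    (LinearEquiv.ofBijective (ρ.restrict (fun _ hf => h.bijOn.mapsTo hf) :
      g.kerSC D →ₗ[ℂ] SecC W)
      ⟨fun a b hab => Subtype.ext (h.bijOn.injOn a.2 b.2 (congrArg Subtype.val hab)),
        fun φ => by
          obtain ⟨f, hf, e⟩ := h.bijOn.surjOn φ.2
          exact ⟨⟨f, hf⟩, Subtype.ext e⟩⟩).symm

end CauchySurface

/-! ### Quotients, induced maps and forms -/

section Quotients

variable {X Y : Type*} [AddCommGroup X] [Module ℂ X] [AddCommGroup Y] [Module ℂ Y]

/-- The quotient `E / F` of subspaces (used for `F ≤ E`). -/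
def SubQuot (E F : Submodule ℂ X) : Type _ := ↥E ⧸ F.submoduleOf E

instance (E F : Submodule ℂ X) : AddCommGroup (SubQuot E F) :=
  inferInstanceAs (AddCommGroup (↥E ⧸ F.submoduleOf E))

instance (E F : Submodule ℂ X) : Module ℂ (SubQuot E F) :=
  inferInstanceAs (Module ℂ (↥E ⧸ F.submoduleOf E))

/-- The class of `e ∈ E` in `E / F`. -/
def cls {E : Submodule ℂ X} (F : Submodule ℂ X) (e : X) (he : e ∈ E) : SubQuot E F :=
  Submodule.Quotient.mk (p := F.submoduleOf E) ⟨e, he⟩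

/-- `Φ : E / F → E' / F'` is the map `[A]` induced by `A`; in particular `A E ⊆ E'`. -/
def IsInducedBy {E F : Submodule ℂ X} {E' F' : Submodule ℂ Y} (A : X →ₗ[ℂ] Y)
    (Φ : SubQuot E F ≃ₗ[ℂ] SubQuot E' F') : Prop :=
  ∀ (e : X) (he : e ∈ E), ∃ he' : A e ∈ E', Φ (cls F e he) = cls F' (A e) he'

/-- Sesquilinear forms, antilinear in the first argument. -/
abbrev Sesq (V : Type*) [AddCommGroup V] [Module ℂ V] : Type _ := V →ₗ⋆[ℂ] V →ₗ[ℂ] ℂ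

end Quotients

/-! ### The subsidiary condition framework -/

section Framework

variable {d : ℕ} {M : Type u} [TopologicalSpace M] [T2Space M] [SigmaCompactSpace M]
  [ChartedSpace (EuclideanSpace ℝ (Fin (d + 1))) M] [IsManifold (𝓡 (d + 1)) ∞ M]
  [MeasurableSpace M]

/-- The data of a linearised gauge theory with subsidiary condition. The field `Kadj` is the
formal adjoint `K^*`. -/
structure SubsidiaryData (g : Spacetime d M) (V₀ V₁ : HermitianBundle.{u, v} (d + 1) M) where
  P : Sec V₁ →ₗ[ℂ] Sec V₁
  K : Sec V₀ →ₗ[ℂ] Sec V₁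
  Kadj : Sec V₁ →ₗ[ℂ] Sec V₀
  T : Sec V₀ →ₗ[ℂ] Sec V₁
  P_selfAdjoint : IsFormalAdjoint g.vol P P
  K_adjoint : IsFormalAdjoint g.vol K Kadj
  T_diffOp : IsDiffOp T
  K_ne_zero : K ≠ 0
  PK_eq_zero : P ∘ₗ K = 0
  green_R : g.GreenHyperbolic (Kadj ∘ₗ K)
  green_D : g.GreenHyperbolic (P + T ∘ₗ Kadj)
  green_Q : g.GreenHyperbolic (Kadj ∘ₗ T)

namespace SubsidiaryData

variable {g : Spacetime d M} {V₀ V₁ : HermitianBundle.{u, v} (d + 1) M}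
  (X : SubsidiaryData g V₀ V₁)

/-- `R = K^* K`. -/
def R : Sec V₀ →ₗ[ℂ] Sec V₀ := X.Kadj ∘ₗ X.K

/-- `D = P + T K^*`. -/
def D : Sec V₁ →ₗ[ℂ] Sec V₁ := X.P + X.T ∘ₗ X.Kadj

/-- `Q = K^* T`. -/
def Q : Sec V₀ →ₗ[ℂ] Sec V₀ := X.Kadj ∘ₗ X.T

/-- The causal propagator `G_D`. -/
def GD : SecC V₁ →ₗ[ℂ] Sec V₁ := g.causalPropagator X.green_D

/-- `Ker K^*|_{Γ_c}`. -/
def kerKadjC : Submodule ℂ (SecC V₁) := (LinearMap.ker X.Kadj).comap (SecC V₁).subtype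

/-- `Ran P|_{Γ_c}`. -/
def ranPC : Submodule ℂ (SecC V₁) := ((SecC V₁).map X.P).comap (SecC V₁).subtype

/-- `Ran T|_{Γ_c}`. -/
def ranTC : Submodule ℂ (SecC V₁) := ((SecC V₀).map X.T).comap (SecC V₁).subtype

/-- `Ker D|_{Γ_sc} ∩ Ker K^*|_{Γ_sc}`. -/
def solSpace : Submodule ℂ (Sec V₁) := g.kerSC X.D ⊓ g.kerSC X.Kadj

/-- `Ran G_D T|_{Γ_c}`. -/
def ranGDT : Submodule ℂ (Sec V₁) := X.ranTC.map X.GD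

variable {S : Type w} [TopologicalSpace S] [ChartedSpace (EuclideanSpace ℝ (Fin d)) S]
  [IsManifold (𝓡 d) ∞ S] {C : CauchySurface g S} {WR WD WQ : HermitianBundle.{w, v} d S}
  {ρR : Sec V₀ →ₗ[ℂ] Sec WR} {ρD : Sec V₁ →ₗ[ℂ] Sec WD} {ρQ : Sec V₀ →ₗ[ℂ] Sec WQ}

/-- `K_Σ = ρ_D K U_R` on `Γ_c`. -/
def KSigma (hR : C.IsCauchyHyperbolic X.R ρR) (ρD : Sec V₁ →ₗ[ℂ] Sec WD) :
    SecC WR →ₗ[ℂ] Sec WD :=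
  ρD ∘ₗ X.K ∘ₗ CauchySurface.solution hR

/-- `K_Σ^† = ρ_Q K^* U_D` on `Γ_c`. -/
def KSigmaDagger (hD : C.IsCauchyHyperbolic X.D ρD) (ρQ : Sec V₀ →ₗ[ℂ] Sec WQ) :
    SecC WD →ₗ[ℂ] Sec WQ :=
  ρQ ∘ₗ X.Kadj ∘ₗ CauchySurface.solution hD

/-- `Ker K_Σ^†|_{Γ_c}`. -/
def kerKSigmaDagger (hD : C.IsCauchyHyperbolic X.D ρD) (ρQ : Sec V₀ →ₗ[ℂ] Sec WQ) :
    Submodule ℂ (Sec WD) :=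
  (LinearMap.ker (X.KSigmaDagger hD ρQ)).map (SecC WD).subtype

/-- `Ran K_Σ|_{Γ_c}`. -/
def ranKSigma (hR : C.IsCauchyHyperbolic X.R ρR) (ρD : Sec V₁ →ₗ[ℂ] Sec WD) :
    Submodule ℂ (Sec WD) :=
  LinearMap.range (X.KSigma hR ρD)

/-- For formally self-adjoint `D` (so that `G_D^* = -G_D`), `GS` is the operator
`G_{DΣ} : Γ_c(Σ) → Γ_c(Σ)` with `G_D = - G_D ρ_D^* G_{DΣ} ρ_D G_D`; this identity is written
weakly, as `(s | G_D t) = (ρ_D G_D s | G_{DΣ} ρ_D G_D t)` for all `s, t` in `Γ_c`. -/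
def IsSurfacePropagator [T2Space S] [SigmaCompactSpace S] [MeasurableSpace S]
    (C : CauchySurface g S) (ρD : Sec V₁ →ₗ[ℂ] Sec WD) (GS : SecC WD →ₗ[ℂ] SecC WD) : Prop :=
  ∀ (s t : SecC V₁) (φ ψ : SecC WD), ρD (X.GD s) = φ → ρD (X.GD t) = ψ →
    pairing g.vol (s : Sec V₁) (X.GD t) = pairing C.vol (φ : Sec WD) (GS ψ)

/-- `V_P = Ker K^*|_{Γ_c} / Ran P|_{Γ_c}`. -/
abbrev VP : Type _ := SubQuot X.kerKadjC X.ranPC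

/-- `q` is the form `q_P` on `V_P`, i.e. `q([s], [t]) = i⁻¹ (s | G_D t)`. -/
def IsqP (q : Sesq X.VP) : Prop :=
  ∀ (s t : SecC V₁) (hs : s ∈ X.kerKadjC) (ht : t ∈ X.kerKadjC),
    q (cls X.ranPC s hs) (cls X.ranPC t ht) =
      Complex.I⁻¹ * pairing g.vol (s : Sec V₁) (X.GD t)

/-- `V_ΣP = Ker K_Σ^†|_{Γ_c} / Ran K_Σ|_{Γ_c}`. -/
abbrev VSigma (hR : C.IsCauchyHyperbolic X.R ρR) (hD : C.IsCauchyHyperbolic X.D ρD)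
    (ρQ : Sec V₀ →ₗ[ℂ] Sec WQ) : Type _ :=
  SubQuot (X.kerKSigmaDagger hD ρQ) (X.ranKSigma hR ρD)

/-- The identity `q([φ], [ψ]) = i⁻¹ (φ | G_{DΣ} ψ)` for the representatives `φ` and `ψ`. -/
def FormulaAt [T2Space S] [SigmaCompactSpace S] [MeasurableSpace S]
    {hR : C.IsCauchyHyperbolic X.R ρR} {hD : C.IsCauchyHyperbolic X.D ρD}
    {ρQ : Sec V₀ →ₗ[ℂ] Sec WQ} (q : Sesq (X.VSigma hR hD ρQ)) (GS : SecC WD →ₗ[ℂ] SecC WD)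
    (φ ψ : SecC WD) : Prop :=
  ∀ (hφ : (φ : Sec WD) ∈ X.kerKSigmaDagger hD ρQ) (hψ : (ψ : Sec WD) ∈ X.kerKSigmaDagger hD ρQ),
    q (cls (X.ranKSigma hR ρD) φ hφ) (cls (X.ranKSigma hR ρD) ψ hψ) =
      Complex.I⁻¹ * pairing C.vol (φ : Sec WD) (GS ψ)

end SubsidiaryData

end Framework

end GaugeTheory

end

/-! Everything rests on two intertwining identities. From `P K = 0` comes `D K = T R`, and from the
adjoint identity `K^* P = 0` comes `K^* D = Q K^*`. Uniqueness of past or future compact solutions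
transfers them to the causal propagators: `G_D T = K G_R` (`GD_TC`) and `K^* G_D = G_Q K^*`
(`Kadj_GD`). Global hyperbolicity also makes `D`, `G_D` exact: the kernel of `G_D` on `Γ_c` is `D
Γ_c`, and its range is `Ker D` on `Γ_sc` (`exists_of_causalPropagator_eq_zero`,
`exists_causalPropagator_eq_of_mem_kerSC`; likewise for `R` and `Q`).

Hence `G_D` identifies `Ker K^* / Ran P` with the solutions in `Ker K^*` modulo `Ran G_D T`. If `K^*
G_D u = 0`, then `G_Q K^* u = 0`, so `K^* u = Q h = K^* T h`, and `u - T h` lies in `Ker K^*`. If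
`K^* s = 0` and `G_D s = G_D T h`, then `s - T h = D t`; applying `K^*` gives `Q (K^* t + h) = 0`,
so `h = -K^* t` and `s = P t`. The bijection `ρ_D` carries these solutions to `Ker K_Σ^†`, because
`K^* f` solves `Q` and is determined by its data, and carries `Ran G_D T = Ran K G_R` to `Ran K_Σ`.

For the formula on the surface, data in `Ker K_Σ^†` are written as `ρ_D G_D (s + T h)` and `ρ_D G_D
(t + T k)` with `s`, `t` in `Ker K^*`. The class only sees `s` and `t`, while the right side expands
to `(s|G_D t)` plus cross terms. The term `(s|G_D T k) = (K^* s|G_R k)` vanishes, so the error is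
`(T h|G_D t) + (T h|G_D T k)` (`formulaAt_iff`). It vanishes for `T = K`; for `D = D^*` its first
term vanishes because `G_D` is antihermitian, and isotropy of `Ran T` is what remains. -/

namespace GaugeTheory

/-! ### Tangent vectors in charts -/

section ChartVectors

variable {n : ℕ} {M : Type u} [TopologicalSpace M] [ChartedSpace (EuclideanSpace ℝ (Fin n)) M]

/-- The tangent vector at `φ⁻¹ y` with coordinates `a` in the chart `φ` around `p`. -/
noncomputable def chartVec (p : M) (y a : EuclideanSpace ℝ (Fin n)) :
    TangentSpace (𝓡 n) ((extChartAt (𝓡 n) p).symm y) :=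
  mfderiv (𝓡 n) (𝓡 n) (extChartAt (𝓡 n) p).symm y a

theorem chartVec_smul (p : M) (y a : EuclideanSpace ℝ (Fin n)) (c : ℝ) :
    chartVec p y (c • a) = c • chartVec p y a :=
  map_smul (mfderiv (𝓡 n) (𝓡 n) (extChartAt (𝓡 n) p).symm y) c a

theorem chartVec_sum {ι : Type*} (s : Finset ι) (p : M) (y : EuclideanSpace ℝ (Fin n))
    (a : ι → EuclideanSpace ℝ (Fin n)) :
    chartVec p y (∑ i ∈ s, a i) = ∑ i ∈ s, chartVec p y (a i) :=
  map_sum (mfderiv (𝓡 n) (𝓡 n) (extChartAt (𝓡 n) p).symm y) a s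

variable [IsManifold (𝓡 n) ∞ M]

/-- Bijectivity and joint continuity of `chartVec` are inherited from the trivialisation of the
tangent bundle through this identification. -/
theorem chartVec_eq_symmL (p : M) {y : EuclideanSpace ℝ (Fin n)}
    (hy : y ∈ (extChartAt (𝓡 n) p).target) (a : EuclideanSpace ℝ (Fin n)) :
    chartVec p y a = (trivializationAt (EuclideanSpace ℝ (Fin n))
      (TangentSpace (𝓡 n) : M → Type _) p).symmL ℝ ((extChartAt (𝓡 n) p).symm y) a := by
  have : IsManifold (𝓡 n) 1 M := IsManifold.of_le (n := ∞) (by simp)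
  have hx : (extChartAt (𝓡 n) p).symm y ∈ (chartAt (EuclideanSpace ℝ (Fin n)) p).source := by
    rw [← extChartAt_source (𝓡 n)]
    exact (extChartAt (𝓡 n) p).map_target hy
  have h := TangentBundle.symmL_trivializationAt (I := 𝓡 n) (𝕜 := ℝ) hx
  rw [ModelWithCorners.range_eq_univ, mfderivWithin_univ, (extChartAt (𝓡 n) p).right_inv hy] at h
  exact (congrArg (fun L => L a) h).symm

theorem chartVec_surjective (p : M) {y : EuclideanSpace ℝ (Fin n)}
    (hy : y ∈ (extChartAt (𝓡 n) p).target) : Function.Surjective (chartVec p y) := by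
  intro v
  set e := trivializationAt (EuclideanSpace ℝ (Fin n)) (TangentSpace (𝓡 n) : M → Type _) p
  have hx : (extChartAt (𝓡 n) p).symm y ∈ e.baseSet := by
    have := (extChartAt (𝓡 n) p).map_target hy
    rwa [extChartAt_source] at this
  exact ⟨e.continuousLinearMapAt ℝ _ v, (chartVec_eq_symmL p hy _).trans
    (e.symmL_continuousLinearMapAt (R := ℝ) hx v)⟩

theorem chartVec_injective (p : M) {y : EuclideanSpace ℝ (Fin n)}
    (hy : y ∈ (extChartAt (𝓡 n) p).target) : Function.Injective (chartVec p y) := by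
  intro a b hab
  set e := trivializationAt (EuclideanSpace ℝ (Fin n)) (TangentSpace (𝓡 n) : M → Type _) p
  have hx : (extChartAt (𝓡 n) p).symm y ∈ e.baseSet := by
    have := (extChartAt (𝓡 n) p).map_target hy
    rwa [extChartAt_source] at this
  rw [chartVec_eq_symmL p hy, chartVec_eq_symmL p hy] at hab
  have h := congrArg (e.continuousLinearMapAt ℝ _) hab
  exact ((e.continuousLinearMapAt_symmL (R := ℝ) hx a).symm.trans h).trans
    (e.continuousLinearMapAt_symmL (R := ℝ) hx b)

/-- Continuity is joint in base point and coordinates, so that open conditions on the metric survive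
a perturbation of both. -/
theorem continuousOn_chartVec (p : M) :
    ContinuousOn (fun z : EuclideanSpace ℝ (Fin n) × EuclideanSpace ℝ (Fin n) =>
      (⟨(extChartAt (𝓡 n) p).symm z.1, chartVec p z.1 z.2⟩ : TangentBundle (𝓡 n) M))
      ((extChartAt (𝓡 n) p).target ×ˢ univ) := by
  set e := trivializationAt (EuclideanSpace ℝ (Fin n)) (TangentSpace (𝓡 n) : M → Type _) p with he
  have hbase : ∀ z : EuclideanSpace ℝ (Fin n) × EuclideanSpace ℝ (Fin n),
      z ∈ (extChartAt (𝓡 n) p).target ×ˢ univ → (extChartAt (𝓡 n) p).symm z.1 ∈ e.baseSet := by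
    intro z hz
    have := (extChartAt (𝓡 n) p).map_target hz.1
    rwa [extChartAt_source] at this
  have h : ContinuousOn (fun z : EuclideanSpace ℝ (Fin n) × EuclideanSpace ℝ (Fin n) =>
      e.toOpenPartialHomeomorph.symm ((extChartAt (𝓡 n) p).symm z.1, z.2))
      ((extChartAt (𝓡 n) p).target ×ˢ univ) := by
    refine e.toOpenPartialHomeomorph.continuousOn_symm.comp
      (f := fun z : EuclideanSpace ℝ (Fin n) × EuclideanSpace ℝ (Fin n) =>
        ((extChartAt (𝓡 n) p).symm z.1, z.2)) ?_ ?_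
    · exact ((continuousOn_extChartAt_symm p).comp continuousOn_fst fun z hz => hz.1).prodMk
        continuousOn_snd
    · intro z hz
      exact e.mem_target.mpr (hbase z hz)
  refine h.congr fun z hz => ?_
  refine Eq.trans ?_ (e.mk_symm (hbase z hz) z.2)
  refine congrArg (TotalSpace.mk' (EuclideanSpace ℝ (Fin n))
    (E := (TangentSpace (𝓡 n) : M → Type _)) _) ?_
  rw [chartVec_eq_symmL p hz.1 z.2, e.symmL_apply (hbase z hz)]

end ChartVectors

/-! ### The metric in chart coordinates -/

namespace Spacetime

section Charts

variable {d : ℕ} {M : Type u} [TopologicalSpace M]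
  [ChartedSpace (EuclideanSpace ℝ (Fin (d + 1))) M] [IsManifold (𝓡 (d + 1)) ∞ M]
  (g : Spacetime d M)

theorem continuousOn_metric {X : Type*} [TopologicalSpace X] {s : Set X} {b : X → M}
    {v w : ∀ x, TangentSpace (𝓡 (d + 1)) (b x)}
    (hv : ContinuousOn (fun x => (⟨b x, v x⟩ : TangentBundle (𝓡 (d + 1)) M)) s)
    (hw : ContinuousOn (fun x => (⟨b x, w x⟩ : TangentBundle (𝓡 (d + 1)) M)) s) :
    ContinuousOn (fun x => g.metric (b x) (v x) (w x)) s := by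
  have hb : ContinuousOn b s :=
    (FiberBundle.continuous_proj (EuclideanSpace ℝ (Fin (d + 1)))
      (TangentSpace (𝓡 (d + 1)) : M → Type _)).comp_continuousOn hv
  have hg := g.smooth_metric.continuous.comp_continuousOn hb
  have h := ContinuousOn.clm_bundle_apply₂ (𝕜 := ℝ) (F₃ := ℝ) (E₃ := fun _ : M => ℝ) (b := b)
    (ψ := fun x => g.metric (b x)) hg hv hw
  -- The bundle evaluation takes values in the total space of the trivial line bundle; its fibre
  -- component is the function in question.
  intro x hx
  have h' := h x hx
  rw [FiberBundle.continuousWithinAt_totalSpace] at h'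
  exact h'.2

theorem continuousOn_metric_chartVec (p : M) :
    ContinuousOn (fun z : EuclideanSpace ℝ (Fin (d + 1)) ×
        (EuclideanSpace ℝ (Fin (d + 1)) × EuclideanSpace ℝ (Fin (d + 1))) =>
      g.metric ((extChartAt (𝓡 (d + 1)) p).symm z.1) (chartVec p z.1 z.2.1)
        (chartVec p z.1 z.2.2)) ((extChartAt (𝓡 (d + 1)) p).target ×ˢ univ) := by
  refine g.continuousOn_metric
    ((continuousOn_chartVec p).comp (f := fun z : EuclideanSpace ℝ (Fin (d + 1)) ×
        (EuclideanSpace ℝ (Fin (d + 1)) × EuclideanSpace ℝ (Fin (d + 1))) => (z.1, z.2.1))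
      (by fun_prop) fun z hz => ⟨hz.1, mem_univ _⟩)
    ((continuousOn_chartVec p).comp (f := fun z : EuclideanSpace ℝ (Fin (d + 1)) ×
        (EuclideanSpace ℝ (Fin (d + 1)) × EuclideanSpace ℝ (Fin (d + 1))) => (z.1, z.2.2))
      (by fun_prop) fun z hz => ⟨hz.1, mem_univ _⟩)

theorem continuousOn_timeField_chartVec (p : M) :
    ContinuousOn (fun z : EuclideanSpace ℝ (Fin (d + 1)) × EuclideanSpace ℝ (Fin (d + 1)) =>
      g.metric ((extChartAt (𝓡 (d + 1)) p).symm z.1)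
        (g.timeField ((extChartAt (𝓡 (d + 1)) p).symm z.1)) (chartVec p z.1 z.2))
      ((extChartAt (𝓡 (d + 1)) p).target ×ˢ univ) :=
  g.continuousOn_metric
    (g.smooth_timeField.continuous.comp_continuousOn
      ((continuousOn_extChartAt_symm p).comp continuousOn_fst fun _ hz => hz.1))
    (continuousOn_chartVec p)

/-- Such a `u` is orthogonal to a timelike `v`, and the metric is positive definite on the
orthogonal complement of `v`. -/
theorem metric_nondegenerate (x : M) (u : TangentSpace (𝓡 (d + 1)) x)
    (h : ∀ w, g.metric x w u = 0) : u = 0 := by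
  obtain ⟨v, -, hv⟩ := g.lorentzian x
  by_contra hu
  exact absurd (hv u (h v) hu) (by rw [h u]; exact lt_irrefl 0)

end Charts

end Spacetime

namespace Spacetime

/-! ### Local causality -/

section LocalCausality

/-- A diffeomorphism of `ℝ` onto `(-1/2, 3/2)` fixing `0` and `1`. -/
noncomputable def squash (t : ℝ) : ℝ := 1 / 2 + 2 / Real.pi * Real.arctan (2 * t - 1)

theorem squash_zero : squash 0 = 0 := by
  have := Real.pi_ne_zero
  simp only [squash, mul_zero, zero_sub, Real.arctan_neg, Real.arctan_one]
  field_simp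
  norm_num

theorem squash_one : squash 1 = 1 := by
  have := Real.pi_ne_zero
  have h : (2 : ℝ) * 1 - 1 = 1 := by norm_num
  simp only [squash, h, Real.arctan_one]
  field_simp
  norm_num

theorem squash_mem_Ioo (t : ℝ) : squash t ∈ Ioo (-1 : ℝ) 2 := by
  have hp := Real.pi_pos
  have h1 := Real.neg_pi_div_two_lt_arctan (2 * t - 1)
  have h2 := Real.arctan_lt_pi_div_two (2 * t - 1)
  have e : Real.pi * (2 / Real.pi * Real.arctan (2 * t - 1)) = 2 * Real.arctan (2 * t - 1) := by
    field_simp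
  constructor <;> unfold squash <;> nlinarith

theorem hasDerivAt_squash (t : ℝ) :
    HasDerivAt squash (2 / Real.pi * (1 / (1 + (2 * t - 1) ^ 2) * 2)) t := by
  have h : HasDerivAt (fun t : ℝ => 2 * t - 1) 2 t := by
    simpa using ((hasDerivAt_id t).const_mul 2).sub_const 1
  exact ((h.arctan).const_mul (2 / Real.pi)).const_add (1 / 2)

theorem deriv_squash_pos (t : ℝ) : 0 < 2 / Real.pi * (1 / (1 + (2 * t - 1) ^ 2) * 2) := by
  have := Real.pi_pos
  positivity

theorem contDiff_squash : ContDiff ℝ 1 squash := by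
  unfold squash
  exact contDiff_const.add (contDiff_const.mul (Real.contDiff_arctan.comp (by fun_prop)))

theorem strictMono_squash : StrictMono squash :=
  strictMono_of_deriv_pos fun t => by rw [(hasDerivAt_squash t).deriv]; exact deriv_squash_pos t

theorem squash_mem_Icc {t : ℝ} (ht : t ∈ Icc (0 : ℝ) 1) : squash t ∈ Icc (0 : ℝ) 1 :=
  ⟨squash_zero ▸ strictMono_squash.monotone ht.1, squash_one ▸ strictMono_squash.monotone ht.2⟩

variable {d : ℕ} {M : Type u} [TopologicalSpace M]
  [ChartedSpace (EuclideanSpace ℝ (Fin (d + 1))) M] [IsManifold (𝓡 (d + 1)) ∞ M]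
  (g : Spacetime d M)

theorem FutureCausal.smul {g : Spacetime d M} {x : M} {v : TangentSpace (𝓡 (d + 1)) x}
    (h : g.FutureCausal x v) {c : ℝ} (hc : 0 < c) : g.FutureCausal x (c • v) := by
  constructor
  · rw [map_smul, map_smul, smul_apply, smul_eq_mul, smul_eq_mul]
    exact mul_nonpos_of_nonneg_of_nonpos hc.le (mul_nonpos_of_nonneg_of_nonpos hc.le h.1)
  · rw [map_smul, smul_eq_mul]
    exact mul_neg_of_pos_of_neg hc h.2

/-- A causal step asks for a curve that is `C^1` on all of `ℝ`, whereas the full line through `b`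
and `c` may leave the chart. Reparametrising by `squash` confines the parameter to a bounded
interval, fixes both endpoints, and multiplies the velocity by a positive factor, which preserves
the future causal cone. The interval `(-1, 2)` is a convenient enclosure. -/
theorem causalStep_of_segment (p : M) {b c : EuclideanSpace ℝ (Fin (d + 1))}
    (h : ∀ τ ∈ Ioo (-1 : ℝ) 2, b + τ • (c - b) ∈ (extChartAt (𝓡 (d + 1)) p).target)
    (h' : ∀ τ ∈ Icc (0 : ℝ) 1, g.FutureCausal ((extChartAt (𝓡 (d + 1)) p).symm (b + τ • (c - b)))
      (chartVec p (b + τ • (c - b)) (c - b))) :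
    g.CausalStep ((extChartAt (𝓡 (d + 1)) p).symm b) ((extChartAt (𝓡 (d + 1)) p).symm c) := by
  set σ : ℝ → EuclideanSpace ℝ (Fin (d + 1)) := fun t => b + squash t • (c - b) with hσ
  have hσt : ∀ t, σ t ∈ (extChartAt (𝓡 (d + 1)) p).target := fun t => h _ (squash_mem_Ioo t)
  have hσs : ContDiff ℝ 1 σ := contDiff_const.add (contDiff_squash.smul contDiff_const)
  have hφ : ContMDiffOn (𝓡 (d + 1)) (𝓡 (d + 1)) 1 (extChartAt (𝓡 (d + 1)) p).symm
      (extChartAt (𝓡 (d + 1)) p).target :=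
    (contMDiffOn_extChartAt_symm (n := ∞) p).of_le (by simp)
  refine ⟨fun t => (extChartAt (𝓡 (d + 1)) p).symm (σ t), ?_, ?_, ?_, fun t ht => ?_⟩
  · exact hφ.comp_contMDiff hσs.contMDiff hσt
  · simp [hσ, squash_zero]
  · simp [hσ, squash_one]
  · have hd : HasDerivAt σ ((2 / Real.pi * (1 / (1 + (2 * t - 1) ^ 2) * 2)) • (c - b)) t :=
      ((hasDerivAt_squash t).smul_const (c - b)).const_add b
    have hm : MDifferentiableAt (𝓡 (d + 1)) (𝓡 (d + 1)) (extChartAt (𝓡 (d + 1)) p).symm (σ t) :=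
      ((hφ _ (hσt t)).contMDiffAt ((isOpen_extChartAt_target p).mem_nhds (hσt t))).mdifferentiableAt
        one_ne_zero
    have hv : velocity (fun t => (extChartAt (𝓡 (d + 1)) p).symm (σ t)) t =
        (2 / Real.pi * (1 / (1 + (2 * t - 1) ^ 2) * 2)) • chartVec p (σ t) (c - b) := by
      have hc := mfderiv_comp_apply (I := 𝓘(ℝ, ℝ)) t hm
        hd.differentiableAt.mdifferentiableAt (1 : ℝ)
      rw [mfderiv_eq_fderiv] at hc
      have e : fderiv ℝ σ t (1 : ℝ) = (2 / Real.pi * (1 / (1 + (2 * t - 1) ^ 2) * 2)) • (c - b) := by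
        rw [fderiv_apply_one_eq_deriv, hd.deriv]
      refine Eq.trans hc ?_
      refine Eq.trans (congrArg _ e) ?_
      exact chartVec_smul p (σ t) (c - b) _
    rw [hv]
    exact (h' _ (squash_mem_Icc ht)).smul (deriv_squash_pos t)

/-- Around `p` all sufficiently small segments in the chart whose direction is close to that of
the time field are future directed and causal. -/
theorem exists_causalStep_nhds (p : M) : ∃ (a₀ : EuclideanSpace ℝ (Fin (d + 1))) (r δ : ℝ),
    0 < r ∧ 0 < δ ∧ ∀ ε : ℝ, 0 < ε → ∀ b c : EuclideanSpace ℝ (Fin (d + 1)),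
      (∀ τ ∈ Ioo (-1 : ℝ) 2, ‖b + τ • (c - b) - extChartAt (𝓡 (d + 1)) p p‖ < r) →
      ‖c - b - ε • a₀‖ < ε * δ →
      g.CausalStep ((extChartAt (𝓡 (d + 1)) p).symm b) ((extChartAt (𝓡 (d + 1)) p).symm c) := by
  set y₀ := extChartAt (𝓡 (d + 1)) p p with hy₀
  have hyt : y₀ ∈ (extChartAt (𝓡 (d + 1)) p).target := mem_extChartAt_target p
  have hopen : IsOpen (extChartAt (𝓡 (d + 1)) p).target := isOpen_extChartAt_target p
  have hsymm : (extChartAt (𝓡 (d + 1)) p).symm y₀ = p := extChartAt_to_inv p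
  obtain ⟨a₀, ha₀⟩ := chartVec_surjective p hyt
    (g.timeField ((extChartAt (𝓡 (d + 1)) p).symm y₀))
  have hF : ContinuousAt (fun z : EuclideanSpace ℝ (Fin (d + 1)) × EuclideanSpace ℝ (Fin (d + 1)) =>
      g.metric ((extChartAt (𝓡 (d + 1)) p).symm z.1) (chartVec p z.1 z.2) (chartVec p z.1 z.2))
      (y₀, a₀) :=
    (g.continuousOn_metric (continuousOn_chartVec p) (continuousOn_chartVec p)).continuousAt
      ((hopen.prod isOpen_univ).mem_nhds ⟨hyt, mem_univ _⟩)
  have hH := (g.continuousOn_timeField_chartVec p).continuousAt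
      ((hopen.prod isOpen_univ).mem_nhds (mk_mem_prod hyt (mem_univ a₀)))
  have hneg : g.metric ((extChartAt (𝓡 (d + 1)) p).symm y₀)
      (g.timeField ((extChartAt (𝓡 (d + 1)) p).symm y₀)) (chartVec p y₀ a₀) < 0 := by
    rw [ha₀]; exact g.timelike_timeField _
  have hneg' : g.metric ((extChartAt (𝓡 (d + 1)) p).symm y₀) (chartVec p y₀ a₀)
      (chartVec p y₀ a₀) < 0 := by
    rw [ha₀]; exact g.timelike_timeField _
  have hev := (hF.eventually (Iio_mem_nhds hneg')).and
    ((hH.eventually (Iio_mem_nhds hneg)).and ((hopen.prod isOpen_univ).mem_nhds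
      (mk_mem_prod hyt (mem_univ a₀))))
  obtain ⟨r, hr, hball⟩ := Metric.eventually_nhds_iff.mp hev
  refine ⟨a₀, r, r, hr, hr, fun ε hε b c hbc hdir => ?_⟩
  -- Causality is a cone condition: dividing the direction by `ε` brings it within `r` of `a₀`,
  -- where the open conditions hold, whatever the size of `ε`.
  have key : ∀ τ ∈ Ioo (-1 : ℝ) 2, dist (b + τ • (c - b), ε⁻¹ • (c - b)) (y₀, a₀) < r := by
    intro τ hτ
    rw [Prod.dist_eq]
    refine max_lt ?_ ?_
    · rw [dist_eq_norm]; exact hbc τ hτ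
    · have e : ε⁻¹ • (c - b) - a₀ = ε⁻¹ • (c - b - ε • a₀) := by
        rw [smul_sub _ (c - b), smul_smul, inv_mul_cancel₀ hε.ne', one_smul]
      rw [dist_eq_norm, e, norm_smul, norm_inv, Real.norm_eq_abs, abs_of_pos hε,
        inv_mul_lt_iff₀ hε]
      exact hdir
  refine g.causalStep_of_segment p (fun τ hτ => ((hball (key τ hτ)).2.2).1) fun τ hτ => ?_
  have hτ' : τ ∈ Ioo (-1 : ℝ) 2 := ⟨by linarith [hτ.1], by linarith [hτ.2]⟩
  have hk := hball (key τ hτ')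
  have hfc : g.FutureCausal ((extChartAt (𝓡 (d + 1)) p).symm (b + τ • (c - b)))
      (chartVec p (b + τ • (c - b)) (ε⁻¹ • (c - b))) := ⟨le_of_lt hk.1, hk.2.1⟩
  have := hfc.smul hε
  rwa [← chartVec_smul, smul_smul, mul_inv_cancel₀ hε.ne', one_smul] at this

/-- The weights `1 - τ` and `τ` are at most 2 in absolute value, so the sum stays below `4 r / 5`.
-/
theorem norm_segment_lt {E : Type*} [SeminormedAddCommGroup E] [NormedSpace ℝ E] {b c y : E}
    {r τ : ℝ} (hτ : τ ∈ Ioo (-1 : ℝ) 2) (hb : ‖b - y‖ < r / 5) (hc : ‖c - y‖ < r / 5) :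
    ‖b + τ • (c - b) - y‖ < r := by
  have e : b + τ • (c - b) - y = (1 - τ) • (b - y) + τ • (c - y) := by
    simp only [sub_smul, smul_sub, one_smul]; abel
  have h1 : |1 - τ| ≤ 2 := abs_le.mpr ⟨by linarith [hτ.2], by linarith [hτ.1]⟩
  have h2 : |τ| ≤ 2 := abs_le.mpr ⟨by linarith [hτ.1], by linarith [hτ.2]⟩
  rw [e]
  refine (norm_add_le _ _).trans_lt ?_
  rw [norm_smul, norm_smul, Real.norm_eq_abs, Real.norm_eq_abs]
  nlinarith [norm_nonneg (b - y), norm_nonneg (c - y)]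

theorem exists_small_scale {r δ A : ℝ} (hr : 0 < r) (hδ : 0 < δ) (hA : 0 ≤ A) :
    ∃ ε : ℝ, 0 < ε ∧ ε * A < r ∧ ε * δ < r := by
  refine ⟨r / (A + δ + 1), by positivity, ?_, ?_⟩ <;>
  · rw [div_mul_eq_mul_div, div_lt_iff₀ (by positivity)]
    nlinarith

/-- Take `q` slightly to the past of `p`, displaced by `-ε a₀` in the chart. A point within `ε δ` of
`p` is joined to `q` by a segment whose direction differs from `ε a₀` by less than `ε δ`. With its
time reverse, this is all the local causality theory that the proof needs. -/
theorem exists_nhds_subset_causalFuture (p : M) : ∃ q, g.causalFuture {q} ∈ 𝓝 p := by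
  obtain ⟨a₀, r, δ, hr, hδ, H⟩ := g.exists_causalStep_nhds p
  set y₀ := extChartAt (𝓡 (d + 1)) p p with hy₀
  obtain ⟨ε, hε, h1, h2⟩ := exists_small_scale (r := r / 5) (by positivity) hδ (norm_nonneg a₀)
  refine ⟨(extChartAt (𝓡 (d + 1)) p).symm (y₀ - ε • a₀), ?_⟩
  have hc : ∀ᶠ x in 𝓝 p, ‖extChartAt (𝓡 (d + 1)) p x - y₀‖ < ε * δ := by
    have := ((continuousAt_extChartAt (I := 𝓡 (d + 1)) p).sub (continuousAt_const (y := y₀))).norm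
    refine this.eventually_lt continuousAt_const ?_
    simp [hy₀]; positivity
  filter_upwards [hc, extChartAt_source_mem_nhds (I := 𝓡 (d + 1)) p] with x hx hxs
  refine ⟨_, rfl, Relation.ReflTransGen.single ?_⟩
  rw [← (extChartAt (𝓡 (d + 1)) p).left_inv hxs]
  refine H ε hε _ _ (fun τ hτ => norm_segment_lt hτ ?_ (hx.trans h2)) ?_
  · rwa [sub_sub_cancel_left, norm_neg, norm_smul, Real.norm_eq_abs, abs_of_pos hε]
  · rwa [sub_sub_eq_add_sub, sub_right_comm, add_sub_cancel_right]

theorem exists_nhds_subset_causalPast (p : M) : ∃ q, g.causalPast {q} ∈ 𝓝 p := by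
  obtain ⟨a₀, r, δ, hr, hδ, H⟩ := g.exists_causalStep_nhds p
  set y₀ := extChartAt (𝓡 (d + 1)) p p with hy₀
  obtain ⟨ε, hε, h1, h2⟩ := exists_small_scale (r := r / 5) (by positivity) hδ (norm_nonneg a₀)
  refine ⟨(extChartAt (𝓡 (d + 1)) p).symm (y₀ + ε • a₀), ?_⟩
  have hc : ∀ᶠ x in 𝓝 p, ‖extChartAt (𝓡 (d + 1)) p x - y₀‖ < ε * δ := by
    have := ((continuousAt_extChartAt (I := 𝓡 (d + 1)) p).sub (continuousAt_const (y := y₀))).norm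
    refine this.eventually_lt continuousAt_const ?_
    simp [hy₀]; positivity
  filter_upwards [hc, extChartAt_source_mem_nhds (I := 𝓡 (d + 1)) p] with x hx hxs
  refine ⟨_, rfl, Relation.ReflTransGen.single ?_⟩
  rw [← (extChartAt (𝓡 (d + 1)) p).left_inv hxs]
  refine H ε hε _ _ (fun τ hτ => norm_segment_lt hτ (hx.trans h2) ?_) ?_
  · rwa [add_sub_cancel_left, norm_smul, Real.norm_eq_abs, abs_of_pos hε]
  · rwa [sub_right_comm, add_sub_cancel_right, norm_sub_rev]

end LocalCausality

end Spacetime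

namespace Spacetime

/-! ### Global hyperbolicity -/

section GlobalCausality

variable {d : ℕ} {M : Type u} [TopologicalSpace M]
  [ChartedSpace (EuclideanSpace ℝ (Fin (d + 1))) M] [IsManifold (𝓡 (d + 1)) ∞ M]
  {g : Spacetime d M}

theorem subset_causalFuture (A : Set M) : A ⊆ g.causalFuture A :=
  fun x hx => ⟨x, hx, Relation.ReflTransGen.refl⟩

theorem subset_causalPast (A : Set M) : A ⊆ g.causalPast A :=
  fun x hx => ⟨x, hx, Relation.ReflTransGen.refl⟩

theorem causalFuture_mono {A B : Set M} (h : A ⊆ B) : g.causalFuture A ⊆ g.causalFuture B :=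
  fun _ ⟨p, hp, hpx⟩ => ⟨p, h hp, hpx⟩

theorem causalPast_mono {A B : Set M} (h : A ⊆ B) : g.causalPast A ⊆ g.causalPast B :=
  fun _ ⟨p, hp, hpx⟩ => ⟨p, h hp, hpx⟩

theorem causalFuture_subset_of_subset {A B : Set M} (h : A ⊆ g.causalFuture B) :
    g.causalFuture A ⊆ g.causalFuture B := by
  rintro x ⟨p, hp, hpx⟩
  obtain ⟨q, hq, hqp⟩ := h hp
  exact ⟨q, hq, hqp.trans hpx⟩

theorem causalPast_subset_of_subset {A B : Set M} (h : A ⊆ g.causalPast B) :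
    g.causalPast A ⊆ g.causalPast B := by
  rintro x ⟨p, hp, hpx⟩
  obtain ⟨q, hq, hqp⟩ := h hp
  exact ⟨q, hq, hpx.trans hqp⟩

theorem causalFuture_eq_biUnion (A : Set M) :
    g.causalFuture A = ⋃ p ∈ A, g.causalFuture {p} := by
  ext x; simp [causalFuture]

theorem causalPast_eq_biUnion (A : Set M) :
    g.causalPast A = ⋃ p ∈ A, g.causalPast {p} := by
  ext x; simp [causalPast]

theorem mem_causalPast_singleton {x y : M} :
    y ∈ g.causalPast {x} ↔ x ∈ g.causalFuture {y} := by
  simp [causalFuture, causalPast]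

variable [T2Space M]

/-- Closedness is local: near `x` everything lies in some `J^-(q)`, and `J^+(p) ∩ J^-(q)` is
compact, hence closed. -/
theorem GloballyHyperbolic.isClosed_causalFuture_singleton (hg : g.GloballyHyperbolic) (p : M) :
    IsClosed (g.causalFuture {p}) := by
  refine isClosed_of_closure_subset fun x hx => ?_
  obtain ⟨q, hq⟩ := g.exists_nhds_subset_causalPast x
  have hx' : x ∈ closure (g.causalFuture {p} ∩ g.causalPast {q}) := by
    rw [mem_closure_iff_nhds] at hx ⊢
    intro U hU
    obtain ⟨y, hy, hyp⟩ := hx _ (Filter.inter_mem hU hq)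
    exact ⟨y, hy.1, hyp, hy.2⟩
  exact ((hg.2 p q).isClosed.closure_subset hx').1

theorem GloballyHyperbolic.isClosed_causalPast_singleton (hg : g.GloballyHyperbolic) (p : M) :
    IsClosed (g.causalPast {p}) := by
  refine isClosed_of_closure_subset fun x hx => ?_
  obtain ⟨q, hq⟩ := g.exists_nhds_subset_causalFuture x
  have hx' : x ∈ closure (g.causalFuture {q} ∩ g.causalPast {p}) := by
    rw [mem_closure_iff_nhds] at hx ⊢
    intro U hU
    obtain ⟨y, hy, hyp⟩ := hx _ (Filter.inter_mem hU hq)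
    exact ⟨y, hy.1, hy.2, hyp⟩
  exact ((hg.2 q p).isClosed.closure_subset hx').2

theorem GloballyHyperbolic.isClosed_causalFuture (hg : g.GloballyHyperbolic) {F : Set M}
    (hF : F.Finite) : IsClosed (g.causalFuture F) := by
  rw [causalFuture_eq_biUnion]
  exact hF.isClosed_biUnion fun p _ => hg.isClosed_causalFuture_singleton p

theorem GloballyHyperbolic.isClosed_causalPast (hg : g.GloballyHyperbolic) {F : Set M}
    (hF : F.Finite) : IsClosed (g.causalPast F) := by
  rw [causalPast_eq_biUnion]
  exact hF.isClosed_biUnion fun p _ => hg.isClosed_causalPast_singleton p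

omit [T2Space M] in
theorem GloballyHyperbolic.isCompact_inter (hg : g.GloballyHyperbolic) {F G : Set M}
    (hF : F.Finite) (hG : G.Finite) : IsCompact (g.causalFuture F ∩ g.causalPast G) := by
  rw [causalFuture_eq_biUnion, causalPast_eq_biUnion, iUnion₂_inter]
  refine hF.isCompact_biUnion fun p _ => ?_
  rw [inter_iUnion₂]
  exact hG.isCompact_biUnion fun q _ => hg.2 p q

variable (g)

omit [T2Space M] in
-- Finitely many of the neighbourhoods `J^+(q)` cover `K`. This replaces compact sets by finite
-- ones, for which closed futures and compact diamonds are at hand.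
theorem exists_finite_causalFuture {K : Set M} (hK : IsCompact K) :
    ∃ F : Set M, F.Finite ∧ g.causalFuture K ⊆ g.causalFuture F := by
  choose q hq using g.exists_nhds_subset_causalFuture
  obtain ⟨t, -, ht⟩ := hK.elim_nhds_subcover (fun x => g.causalFuture {q x}) fun x _ => hq x
  refine ⟨q '' t, t.finite_toSet.image q, causalFuture_subset_of_subset fun x hx => ?_⟩
  obtain ⟨y, hy, hxy⟩ := mem_iUnion₂.mp (ht hx)
  exact causalFuture_mono (singleton_subset_iff.mpr (mem_image_of_mem q hy)) hxy

omit [T2Space M] in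
theorem exists_finite_causalPast {K : Set M} (hK : IsCompact K) :
    ∃ F : Set M, F.Finite ∧ g.causalPast K ⊆ g.causalPast F := by
  choose q hq using g.exists_nhds_subset_causalPast
  obtain ⟨t, -, ht⟩ := hK.elim_nhds_subcover (fun x => g.causalPast {q x}) fun x _ => hq x
  refine ⟨q '' t, t.finite_toSet.image q, causalPast_subset_of_subset fun x hx => ?_⟩
  obtain ⟨y, hy, hxy⟩ := mem_iUnion₂.mp (ht hx)
  exact causalPast_mono (singleton_subset_iff.mpr (mem_image_of_mem q hy)) hxy

omit [T2Space M] in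
-- A compact enclosure is enough for the applications, because supports are closed.
theorem GloballyHyperbolic.exists_compact_superset {g : Spacetime d M}
    (hg : g.GloballyHyperbolic) {K L : Set M} (hK : IsCompact K) (hL : IsCompact L) :
    ∃ C, IsCompact C ∧ g.causalFuture K ∩ g.causalPast L ⊆ C := by
  obtain ⟨F, hF, hKF⟩ := g.exists_finite_causalFuture hK
  obtain ⟨G, hG, hLG⟩ := g.exists_finite_causalPast hL
  exact ⟨_, hg.isCompact_inter hF hG, inter_subset_inter hKF hLG⟩

/-- The points of `A` in the past of any given point lie in a compact set. -/
def PastCompact (A : Set M) : Prop :=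
  ∀ x, ∃ C, IsCompact C ∧ ∀ y ∈ A, x ∈ g.causalFuture {y} → y ∈ C

/-- The points of `A` in the future of any given point lie in a compact set. -/
def FutureCompact (A : Set M) : Prop :=
  ∀ x, ∃ C, IsCompact C ∧ ∀ y ∈ A, x ∈ g.causalPast {y} → y ∈ C

variable {g}

omit [T2Space M] in
theorem GloballyHyperbolic.pastCompact_causalFuture (hg : g.GloballyHyperbolic) {K : Set M}
    (hK : IsCompact K) : g.PastCompact (g.causalFuture K) := by
  intro x
  obtain ⟨C, hC, h⟩ := hg.exists_compact_superset hK (isCompact_singleton (x := x))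
  exact ⟨C, hC, fun y hy hxy => h ⟨hy, mem_causalPast_singleton.mpr hxy⟩⟩

omit [T2Space M] in
theorem GloballyHyperbolic.futureCompact_causalPast (hg : g.GloballyHyperbolic) {K : Set M}
    (hK : IsCompact K) : g.FutureCompact (g.causalPast K) := by
  intro x
  obtain ⟨C, hC, h⟩ := hg.exists_compact_superset (isCompact_singleton (x := x)) hK
  exact ⟨C, hC, fun y hy hxy => h ⟨mem_causalPast_singleton.mp hxy, hy⟩⟩

omit [T2Space M] in
theorem PastCompact.mono {A B : Set M} (hB : g.PastCompact B) (h : A ⊆ B) : g.PastCompact A :=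
  fun x => (hB x).imp fun _ hC => ⟨hC.1, fun y hy => hC.2 y (h hy)⟩

omit [T2Space M] in
theorem FutureCompact.mono {A B : Set M} (hB : g.FutureCompact B) (h : A ⊆ B) :
    g.FutureCompact A :=
  fun x => (hB x).imp fun _ hC => ⟨hC.1, fun y hy => hC.2 y (h hy)⟩

omit [T2Space M] in
theorem GloballyHyperbolic.exists_compact_superset_of_inter (hg : g.GloballyHyperbolic)
    {K L A : Set M} (hK : IsCompact K) (hL : IsCompact L) (h : A ⊆ g.causalFuture K)
    (h' : A ⊆ g.causalPast L) : ∃ C, IsCompact C ∧ A ⊆ C :=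
  (hg.exists_compact_superset hK hL).imp fun _ hC => ⟨hC.1, (subset_inter h h').trans hC.2⟩

end GlobalCausality

end Spacetime

/-! ### Supports, cut-offs and locality of differential operators -/

section Local

variable {n : ℕ} {M : Type u} [TopologicalSpace M] [ChartedSpace (EuclideanSpace ℝ (Fin n)) M]
  {U V W : HermitianBundle.{u, v} n M}

theorem notMem_supp {s : Sec V} {x : M} : x ∉ supp s ↔ ∀ᶠ y in 𝓝 x, s.1 y = 0 := by
  rw [supp, mem_closure_iff_frequently, Filter.not_frequently]
  simp

theorem subset_supp (s : Sec V) : {x | s.1 x ≠ 0} ⊆ supp s := subset_closure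

theorem eq_zero_of_notMem_supp {s : Sec V} {x : M} (h : x ∉ supp s) : s.1 x = 0 := by
  by_contra h'
  exact h (subset_supp s h')

theorem isClosed_supp (s : Sec V) : IsClosed (supp s) := isClosed_closure

theorem Sec.sub_val (s t : Sec V) : (s - t).1 = s.1 - t.1 := rfl

theorem mulFun_val (f : C^∞⟮𝓡 n, M; ℝ⟯) (s : Sec V) (x : M) :
    (mulFun f s).1 x = (f x : ℂ) • s.1 x := rfl

theorem supp_mulFun_subset (f : C^∞⟮𝓡 n, M; ℝ⟯) (s : Sec V) : supp (mulFun f s) ⊆ supp s := by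
  refine closure_mono fun x hx h => hx ?_
  have h' : s.1 x = 0 := h
  rw [mulFun_val, h', smul_zero]

theorem supp_sub (s t : Sec V) : supp (s - t) ⊆ supp s ∪ supp t := by
  rw [sub_eq_add_neg, ← neg_one_smul ℂ t]
  exact (supp_add _ _).trans (union_subset_union_right _ (supp_smul _ _))

theorem mem_SecC_of_subset {s : Sec V} {K : Set M} (hK : IsCompact K) (h : supp s ⊆ K) :
    s ∈ SecC V :=
  hK.of_isClosed_subset (isClosed_supp s) h

theorem supp_mulFun_subset_of_eq_zero {f : C^∞⟮𝓡 n, M; ℝ⟯} {K : Set M} (hK : IsClosed K)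
    (hf : ∀ x ∉ K, f x = 0) (s : Sec V) : supp (mulFun f s) ⊆ K := by
  refine closure_minimal (fun x hx => ?_) hK
  by_contra h
  exact hx (by rw [mulFun_val, hf x h, Complex.ofReal_zero, zero_smul])

/-- `A s` vanishes where `s` vanishes locally. -/
def IsLocal (A : Sec V →ₗ[ℂ] Sec W) : Prop :=
  ∀ (s : Sec V) (x : M), (∀ᶠ y in 𝓝 x, s.1 y = 0) → (A s).1 x = 0

namespace IsLocal

theorem eventually_eq_zero {A : Sec V →ₗ[ℂ] Sec W} (hA : IsLocal A) {s : Sec V} {x : M}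
    (h : ∀ᶠ y in 𝓝 x, s.1 y = 0) : ∀ᶠ y in 𝓝 x, (A s).1 y = 0 :=
  h.eventually_nhds.mono fun y hy => hA s y hy

theorem supp_subset {A : Sec V →ₗ[ℂ] Sec W} (hA : IsLocal A) (s : Sec V) :
    supp (A s) ⊆ supp s := by
  intro x hx
  by_contra h
  exact notMem_supp.mpr (hA.eventually_eq_zero (notMem_supp.mp h)) hx

theorem mem_SecC {A : Sec V →ₗ[ℂ] Sec W} (hA : IsLocal A) {s : Sec V} (hs : s ∈ SecC V) :
    A s ∈ SecC W :=
  mem_SecC_of_subset hs (hA.supp_subset s)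

theorem eventuallyEq {A : Sec V →ₗ[ℂ] Sec W} (hA : IsLocal A) {s t : Sec V} {x : M}
    (h : ∀ᶠ y in 𝓝 x, s.1 y = t.1 y) : ∀ᶠ y in 𝓝 x, (A s).1 y = (A t).1 y := by
  have h' := hA.eventually_eq_zero (s := s - t) (h.mono fun y hy => by
    rw [Sec.sub_val, Pi.sub_apply, hy, sub_self])
  refine h'.mono fun y hy => ?_
  rw [map_sub, Sec.sub_val, Pi.sub_apply] at hy
  exact sub_eq_zero.mp hy

theorem comp {A : Sec V →ₗ[ℂ] Sec W} {B : Sec U →ₗ[ℂ] Sec V} (hA : IsLocal A)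
    (hB : IsLocal B) : IsLocal (A ∘ₗ B) :=
  fun s x h => hA (B s) x (hB.eventually_eq_zero h)

theorem add {A B : Sec V →ₗ[ℂ] Sec W} (hA : IsLocal A) (hB : IsLocal B) : IsLocal (A + B) := by
  intro s x h
  rw [LinearMap.add_apply, Sec.add_val, Pi.add_apply, hA s x h, hB s x h, add_zero]

end IsLocal

variable [T2Space M] [SigmaCompactSpace M] [IsManifold (𝓡 n) ∞ M]

/-- Induction on the order. If `s` vanishes on a neighbourhood `N` of `x`, choose `f` with `f x = 0`
and `f = 1` off `N`. Then `f s = s`, so the commutator with `f` takes the value `(A s) x` at `x`,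
and it has lower order. -/
theorem IsDiffOp.isLocal {A : Sec V →ₗ[ℂ] Sec W} (hA : IsDiffOp A) : IsLocal A := by
  obtain ⟨k, hk⟩ := hA
  induction k generalizing A with
  | zero =>
    intro s x _
    have h : A = 0 := hk
    rw [h]; rfl
  | succ k ih =>
    intro s x h
    obtain ⟨N, hN, hNo, hxN⟩ := eventually_nhds_iff.mp h
    obtain ⟨f, hf0, hf1, -⟩ := exists_contMDiffMap_zero_one_of_isClosed (n := ⊤) (𝓡 n)
      (isClosed_singleton (x := x)) hNo.isClosed_compl
      (disjoint_singleton_left.mpr fun h => h hxN)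
    have hfs : mulFun f s = s := Subtype.ext <| by
      funext y
      change (f y : ℂ) • s.1 y = s.1 y
      by_cases hy : y ∈ N
      · rw [hN y hy, smul_zero]
      · have e : f y = 1 := hf1 hy
        rw [e, Complex.ofReal_one, one_smul]
    have h0 := ih (hk f) s x h
    rw [LinearMap.sub_apply, LinearMap.comp_apply, LinearMap.comp_apply, hfs, Sec.sub_val,
      Pi.sub_apply, mulFun_val] at h0
    have e : (f.comp ContMDiffMap.id) x = 0 := hf0 rfl
    rwa [e, Complex.ofReal_zero, zero_smul, sub_zero] at h0

variable (n) in
-- The cut-off equals 1 near each point of `K`, not only on `K`, so that local operators do not see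
-- it there.
theorem exists_cutoff {K : Set M} (hK : IsCompact K) : ∃ (χ : C^∞⟮𝓡 n, M; ℝ⟯) (L : Set M),
    IsCompact L ∧ (∀ x ∉ L, χ x = 0) ∧ ∀ x ∈ K, ∀ᶠ y in 𝓝 x, χ y = 1 := by
  have : LocallyCompactSpace M := Manifold.locallyCompact_of_finiteDimensional (𝓡 n)
  obtain ⟨L, hL, hKL⟩ := exists_compact_superset hK
  obtain ⟨χ, h1, h0, -⟩ := exists_contMDiffMap_one_nhds_of_subset_interior (n := ⊤) (𝓡 n)
    hK.isClosed hKL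
  exact ⟨χ, L, hL, h0, fun x hx => h1.filter_mono (nhds_le_nhdsSet hx)⟩

omit [T2Space M] [SigmaCompactSpace M] [IsManifold (𝓡 n) ∞ M] in
theorem mulFun_eventuallyEq {χ : C^∞⟮𝓡 n, M; ℝ⟯} {x : M} (h : ∀ᶠ y in 𝓝 x, χ y = 1) (s : Sec V) :
    ∀ᶠ y in 𝓝 x, (mulFun χ s).1 y = s.1 y :=
  h.mono fun y hy => by rw [mulFun_val, hy, Complex.ofReal_one, one_smul]

end Local

namespace Spacetime

/-! ### Propagators -/

section Propagators

variable {d : ℕ} {M : Type u} [TopologicalSpace M]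
  [ChartedSpace (EuclideanSpace ℝ (Fin (d + 1))) M] [IsManifold (𝓡 (d + 1)) ∞ M]
  {g : Spacetime d M} {V W : HermitianBundle.{u, v} (d + 1) M}

theorem map_mem_SecSC {A : Sec V →ₗ[ℂ] Sec W} (hA : IsLocal A) {s : Sec V}
    (hs : s ∈ g.SecSC V) : A s ∈ g.SecSC W := by
  obtain ⟨K, hK, h⟩ := hs
  exact ⟨K, hK, (hA.supp_subset s).trans h⟩

variable [T2Space M] [SigmaCompactSpace M]

/-- Uniqueness for `D w = 0` in terms of a propagator with supports in `J`. -/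
theorem IsGreen.eq_zero {D : Sec V →ₗ[ℂ] Sec V} {G : SecC V →ₗ[ℂ] Sec V} (hG : IsGreen D G)
    (hD : IsLocal D) {J : Set M → Set M} (hJ : ∀ A, A ⊆ J A)
    (hJ' : ∀ A, ∀ x ∈ J A, ∃ y ∈ A, x ∈ J {y}) (hsupp : ∀ s : SecC V, supp (G s) ⊆ J (supp s.1))
    {w : Sec V} (hw : D w = 0)
    (hc : ∀ x, ∃ C, IsCompact C ∧ ∀ y ∈ supp w, x ∈ J {y} → y ∈ C) : w = 0 := by
  refine Subtype.ext (funext fun x => ?_)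
  change w.1 x = 0
  by_contra hx
  have hxw : x ∈ supp w := subset_supp w hx
  -- The compact set `C` contains all points of `supp w` from which `x` is reached; cutting off
  -- around `C` makes the propagator applicable without changing `w` near `x`.
  obtain ⟨C, hC, hCx⟩ := hc x
  obtain ⟨χ, L, hL, hχ0, hχ1⟩ := exists_cutoff (d + 1) hC
  have hs : mulFun χ w ∈ SecC V :=
    mem_SecC_of_subset hL (supp_mulFun_subset_of_eq_zero hL.isClosed hχ0 w)
  have ht : D (mulFun χ w) ∈ SecC V := hD.mem_SecC hs
  have hGt : G ⟨_, ht⟩ = mulFun χ w := hG.2 ⟨_, hs⟩ ⟨_, ht⟩ rfl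
  have hxC : x ∈ C := hCx x hxw (hJ _ rfl)
  have hxs : x ∈ supp (mulFun χ w) :=
    subset_supp _ (by rwa [mem_ofPred_eq, (mulFun_eventuallyEq (hχ1 x hxC) w).self_of_nhds])
  rw [← hGt] at hxs
  -- As `χ w = G (D (χ w))`, the point `x` is reached from some `y` in the support of `D (χ w)`.
  -- This `y` lies in `C`, near which `D (χ w) = D w = 0`: a contradiction.
  obtain ⟨y, hy, hxy⟩ := hJ' _ x (hsupp _ hxs)
  have hyC : y ∈ C :=
    hCx y (((hD.supp_subset _).trans (supp_mulFun_subset χ w)) hy) hxy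
  refine notMem_supp.mpr ?_ hy
  refine (hD.eventuallyEq (mulFun_eventuallyEq (hχ1 y hyC) w)).mono fun z hz => ?_
  rw [hz, hw]; rfl

theorem IsRetarded.eq_zero {D : Sec V →ₗ[ℂ] Sec V} {G : SecC V →ₗ[ℂ] Sec V}
    (hG : g.IsRetarded D G) (hD : IsLocal D) {w : Sec V} (hw : D w = 0)
    (hc : g.PastCompact (supp w)) : w = 0 :=
  IsGreen.eq_zero hG.1 hD (J := g.causalFuture) subset_causalFuture
    (fun A x hx => by rw [causalFuture_eq_biUnion] at hx; simpa using hx) hG.2 hw hc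

theorem IsAdvanced.eq_zero {D : Sec V →ₗ[ℂ] Sec V} {G : SecC V →ₗ[ℂ] Sec V}
    (hG : g.IsAdvanced D G) (hD : IsLocal D) {w : Sec V} (hw : D w = 0)
    (hc : g.FutureCompact (supp w)) : w = 0 :=
  IsGreen.eq_zero hG.1 hD (J := g.causalPast) subset_causalPast
    (fun A x hx => by rw [causalPast_eq_biUnion] at hx; simpa using hx) hG.2 hw hc

variable [MeasurableSpace M]

theorem exists_causalPropagator_eq {D : Sec V →ₗ[ℂ] Sec V} (hD : g.GreenHyperbolic D) :
    ∃ Gp Gm, g.IsRetarded D Gp ∧ g.IsAdvanced D Gm ∧ g.causalPropagator hD = Gp - Gm :=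
  ⟨_, _, hD.1.1.choose_spec, hD.1.2.choose_spec, rfl⟩

theorem apply_causalPropagator {D : Sec V →ₗ[ℂ] Sec V} (hD : g.GreenHyperbolic D) (s : SecC V) :
    D (g.causalPropagator hD s) = 0 := by
  obtain ⟨Gp, Gm, hp, hm, e⟩ := exists_causalPropagator_eq hD
  rw [e, LinearMap.sub_apply, map_sub, hp.1.1, hm.1.1, sub_self]

theorem causalPropagator_apply {D : Sec V →ₗ[ℂ] Sec V} (hD : g.GreenHyperbolic D)
    {s t : SecC V} (h : D s = t) : g.causalPropagator hD t = 0 := by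
  obtain ⟨Gp, Gm, hp, hm, e⟩ := exists_causalPropagator_eq hD
  rw [e, LinearMap.sub_apply, hp.1.2 s t h, hm.1.2 s t h, sub_self]

theorem causalPropagator_mem_SecSC {D : Sec V →ₗ[ℂ] Sec V} (hD : g.GreenHyperbolic D)
    (s : SecC V) : g.causalPropagator hD s ∈ g.SecSC V := by
  obtain ⟨Gp, Gm, hp, hm, e⟩ := exists_causalPropagator_eq hD
  refine ⟨supp s.1, s.2, ?_⟩
  rw [e]
  exact (supp_sub _ _).trans (union_subset_union (hp.2 s) (hm.2 s))

theorem causalPropagator_mem_kerSC {D : Sec V →ₗ[ℂ] Sec V} (hD : g.GreenHyperbolic D)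
    (s : SecC V) : g.causalPropagator hD s ∈ g.kerSC D :=
  ⟨causalPropagator_mem_SecSC hD s, apply_causalPropagator hD s⟩

/-- Both `H^± t` and `A G^± s` solve `E w = t` with support in `J^±(supp s)`, so they agree by
uniqueness. Used with `A = K`, `B = T` and with `A = B = K^*`. -/
theorem causalPropagator_intertwine (hg : g.GloballyHyperbolic) {D : Sec V →ₗ[ℂ] Sec V}
    {E : Sec W →ₗ[ℂ] Sec W} (hD : g.GreenHyperbolic D) (hE : g.GreenHyperbolic E)
    (hE' : IsLocal E) {A B : Sec V →ₗ[ℂ] Sec W} (hA : IsLocal A) (hB : IsLocal B)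
    (h : E ∘ₗ A = B ∘ₗ D) {s : SecC V} {t : SecC W} (ht : B s = t) :
    g.causalPropagator hE t = A (g.causalPropagator hD s) := by
  obtain ⟨Gp, Gm, hp, hm, e⟩ := exists_causalPropagator_eq hD
  obtain ⟨Hp, Hm, hp', hm', e'⟩ := exists_causalPropagator_eq hE
  have hEA : ∀ u, E (A u) = B (D u) := fun u => LinearMap.congr_fun h u
  have hts : supp t.1 ⊆ supp s.1 := ht ▸ hB.supp_subset s.1
  have h1 : Hp t - A (Gp s) = 0 := by
    refine hp'.eq_zero hE' ?_ ((hg.pastCompact_causalFuture s.2).mono ?_)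
    · rw [map_sub, hp'.1.1, hEA, hp.1.1, ht, sub_self]
    · exact (supp_sub _ _).trans (union_subset ((hp'.2 t).trans (causalFuture_mono hts))
        ((hA.supp_subset _).trans (hp.2 s)))
  have h2 : Hm t - A (Gm s) = 0 := by
    refine hm'.eq_zero hE' ?_ ((hg.futureCompact_causalPast s.2).mono ?_)
    · rw [map_sub, hm'.1.1, hEA, hm.1.1, ht, sub_self]
    · exact (supp_sub _ _).trans (union_subset ((hm'.2 t).trans (causalPast_mono hts))
        ((hA.supp_subset _).trans (hm.2 s)))
  rw [e, e', LinearMap.sub_apply, LinearMap.sub_apply, map_sub, sub_eq_zero.mp h1,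
    sub_eq_zero.mp h2]

/-- If `G^+ s = G^- s`, this section is supported in `J^+(supp s) ∩ J^-(supp s)`, hence compactly,
and `D` maps it to `s`. -/
theorem exists_of_causalPropagator_eq_zero (hg : g.GloballyHyperbolic) {D : Sec V →ₗ[ℂ] Sec V}
    (hD : g.GreenHyperbolic D) {s : SecC V} (hs : g.causalPropagator hD s = 0) :
    ∃ t : SecC V, D t = s := by
  obtain ⟨Gp, Gm, hp, hm, e⟩ := exists_causalPropagator_eq hD
  rw [e, LinearMap.sub_apply, sub_eq_zero] at hs
  obtain ⟨C, hC, h⟩ := hg.exists_compact_superset_of_inter s.2 s.2 (hp.2 s) (hs ▸ hm.2 s)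
  exact ⟨⟨Gp s, mem_SecC_of_subset hC h⟩, hp.1.1 s⟩

/-- Split `f = χ f + (1 - χ) f` into a future and a past part, where `χ` is locally constant on
`supp f` outside a compact `C`. Then `u = D (χ f)` has compact support, and uniqueness gives `χ f =
G^+ u` and `(1 - χ) f = -G^- u`. The cut-off needs no time function: it separates the closed sets
`J^+(F) \ int C` and `J^-(F') \ int C`, which are disjoint because `int C` contains `J^+(F) ∩
J^-(F')`. -/
theorem exists_causalPropagator_eq_of_mem_kerSC (hg : g.GloballyHyperbolic)
    {D : Sec V →ₗ[ℂ] Sec V} (hD : g.GreenHyperbolic D) (hD' : IsLocal D) {f : Sec V}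
    (hf : f ∈ g.kerSC D) : ∃ s : SecC V, g.causalPropagator hD s = f := by
  have : LocallyCompactSpace M := Manifold.locallyCompact_of_finiteDimensional (𝓡 (d + 1))
  obtain ⟨Gp, Gm, hp, hm, e⟩ := exists_causalPropagator_eq hD
  obtain ⟨⟨K, hK, hfK⟩, hDf⟩ := hf
  have hDf : D f = 0 := hDf
  obtain ⟨F, hF, hKF⟩ := g.exists_finite_causalFuture hK
  obtain ⟨F', hF', hKF'⟩ := g.exists_finite_causalPast hK
  obtain ⟨C, hC, hFC⟩ := exists_compact_superset (hg.isCompact_inter hF hF')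
  have hA : IsClosed (g.causalFuture F \ interior C) :=
    (hg.isClosed_causalFuture hF).sdiff isOpen_interior
  have hB : IsClosed (g.causalPast F' \ interior C) :=
    (hg.isClosed_causalPast hF').sdiff isOpen_interior
  have hAB : Disjoint (g.causalPast F' \ interior C) (g.causalFuture F \ interior C) :=
    disjoint_left.mpr fun x hx hx' => hx.2 (hFC ⟨hx'.1, hx.1⟩)
  obtain ⟨χ, hχ0, hχ1, -⟩ := exists_contMDiffMap_zero_one_nhds_of_isClosed (n := ⊤) (𝓡 (d + 1))
    hB hA hAB
  have hχ1' : ∀ x, x ∈ g.causalFuture F → x ∉ interior C → ∀ᶠ y in 𝓝 x, χ y = 1 :=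
    fun x hx hxi => hχ1.filter_mono (nhds_le_nhdsSet (mem_sdiff_of_mem hx hxi))
  have hχ0' : ∀ x, x ∈ g.causalPast F' → x ∉ interior C → ∀ᶠ y in 𝓝 x, χ y = 0 :=
    fun x hx hxi => hχ0.filter_mono (nhds_le_nhdsSet (mem_sdiff_of_mem hx hxi))
  -- Off `C`, at a point of `supp f`, the cut-off is locally 1 or locally 0, so `D (χ f)` is locally
  -- `D f = 0` or `D 0`.
  have hout : ∀ x ∉ C, x ∉ supp (D (mulFun χ f)) := by
    intro x hxC
    by_cases hxf : x ∈ supp f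
    · have hxi : x ∉ interior C := fun h => hxC (interior_subset h)
      rw [notMem_supp]
      rcases hfK hxf with hx | hx
      · have h1 := hχ1' x (hKF hx) hxi
        refine (hD'.eventuallyEq (mulFun_eventuallyEq h1 f)).mono fun y hy => ?_
        rw [hy, hDf]; rfl
      · have h0 := hχ0' x (hKF' hx) hxi
        refine hD'.eventually_eq_zero (h0.mono fun y hy => ?_)
        rw [mulFun_val, hy, Complex.ofReal_zero, zero_smul]
    · exact fun h => hxf (((hD'.supp_subset _).trans (supp_mulFun_subset χ f)) h)
  have hu : D (mulFun χ f) ∈ SecC V :=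
    mem_SecC_of_subset hC fun x hx => by_contra fun h => hout x h hx
  set u : SecC V := ⟨_, hu⟩ with hu'
  -- One compact set whose future contains the supports of both `χ f` and `G^+ u`; `hFK'` plays this
  -- role for the past.
  have hFK : IsCompact (F ∪ C ∪ supp u.1) := (hF.isCompact.union hC).union u.2
  have hFK' : IsCompact (F' ∪ C ∪ supp u.1) := (hF'.isCompact.union hC).union u.2
  have h1 : mulFun χ f - Gp u = 0 := by
    refine hp.eq_zero hD' (by rw [map_sub, hp.1.1, sub_self])
      ((hg.pastCompact_causalFuture hFK).mono ((supp_sub _ _).trans (union_subset ?_ ?_)))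
    · intro x hx
      by_cases hxC : x ∈ C
      · exact subset_causalFuture _ (Or.inl (Or.inr hxC))
      · have hxi : x ∉ interior C := fun h => hxC (interior_subset h)
        rcases hfK (supp_mulFun_subset χ f hx) with h | h
        · exact causalFuture_mono (fun y hy => Or.inl (Or.inl hy)) (hKF h)
        · have h0 := hχ0' x (hKF' h) hxi
          refine absurd hx (notMem_supp.mpr (h0.mono fun y hy => ?_))
          rw [mulFun_val, hy, Complex.ofReal_zero, zero_smul]
    · exact (hp.2 u).trans (causalFuture_mono subset_union_right)
  have h2 : f - mulFun χ f + Gm u = 0 := by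
    refine hm.eq_zero hD' (by rw [map_add, map_sub, hm.1.1, hDf, zero_sub, hu', neg_add_cancel])
      ((hg.futureCompact_causalPast hFK').mono ((supp_add _ _).trans (union_subset ?_ ?_)))
    · intro x hx
      by_cases hxC : x ∈ C
      · exact subset_causalPast _ (Or.inl (Or.inr hxC))
      · have hxi : x ∉ interior C := fun h => hxC (interior_subset h)
        have hxf : x ∈ supp f := by
          rcases supp_sub _ _ hx with h | h
          · exact h
          · exact supp_mulFun_subset χ f h
        rcases hfK hxf with h | h
        · have h1 := hχ1' x (hKF h) hxi
          refine absurd hx (notMem_supp.mpr ((mulFun_eventuallyEq h1 f).mono fun y hy => ?_))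
          rw [Sec.sub_val, Pi.sub_apply, hy, sub_self]
        · exact causalPast_mono (fun y hy => Or.inl (Or.inl hy)) (hKF' h)
    · exact (hm.2 u).trans (causalPast_mono subset_union_right)
  refine ⟨u, ?_⟩
  rw [e, LinearMap.sub_apply, ← sub_eq_zero.mp h1, eq_neg_of_add_eq_zero_right h2]
  abel

end Propagators

end Spacetime

/-! ### The volume measure -/

section VolumeMeasure

variable {n : ℕ} {M : Type u} [TopologicalSpace M] [T2Space M] [SigmaCompactSpace M]
  [ChartedSpace (EuclideanSpace ℝ (Fin n)) M] [IsManifold (𝓡 n) ∞ M] {b : ∀ x : M, TangentSpace (𝓡 n) x → TangentSpace (𝓡 n) x → ℝ}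

theorem chartPartition_subordinate (p : M) :
    tsupport (chartPartition n M p) ⊆ (extChartAt (𝓡 n) p).source := by
  rw [extChartAt_source]
  exact (SmoothPartitionOfUnity.exists_isSubordinate_chartAt_source (𝓡 n) M).choose_spec p

theorem continuousOn_chartDensity (hb : ∀ p, ContinuousOn (volDensity b p)
    (extChartAt (𝓡 n) p).target) (p : M) :
    ContinuousOn (fun y => chartPartition n M p ((extChartAt (𝓡 n) p).symm y) * volDensity b p y)
      (extChartAt (𝓡 n) p).target :=
  (((chartPartition n M p).contMDiff.continuous).comp_continuousOn
    (continuousOn_extChartAt_symm p)).mul (hb p)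

variable [MeasurableSpace M] [BorelSpace M]

theorem volMeasure_apply {A : Set M} (hA : MeasurableSet A) :
    volMeasure b A = ∑' p : M,
      ∫⁻ y in (extChartAt (𝓡 n) p).symm ⁻¹' A ∩ (extChartAt (𝓡 n) p).target,
        ENNReal.ofReal (chartPartition n M p ((extChartAt (𝓡 n) p).symm y) * volDensity b p y) := by
  rw [volMeasure, Measure.sum_apply _ hA]
  refine tsum_congr fun p => ?_
  have ht : MeasurableSet (extChartAt (𝓡 n) p).target := (isOpen_extChartAt_target p).measurableSet
  rw [Measure.map_apply_of_aemeasurable _ hA, withDensity_apply', Measure.restrict_restrict' ht]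
  -- The inverse chart is only known to be continuous on its target, so it is measurable only almost
  -- everywhere for the restricted measure.
  exact ((continuousOn_extChartAt_symm p).aemeasurable ht).mono_ac
    (withDensity_absolutelyContinuous _ _)

/-- By local finiteness only finitely many charts contribute. In each, the density vanishes over `K`
outside the chart image of `K ∩ tsupport`, which is compact inside the target, and there the density
is continuous. Finiteness makes the pairing additive. -/
theorem isFiniteMeasureOnCompacts_volMeasure
    (hb : ∀ p, ContinuousOn (volDensity b p) (extChartAt (𝓡 n) p).target) :
    IsFiniteMeasureOnCompacts (volMeasure b) where
  lt_top_of_isCompact K hK := by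
    rw [volMeasure_apply hK.measurableSet]
    have hfin : {p : M | (Function.support (chartPartition n M p) ∩ K).Nonempty}.Finite :=
      (chartPartition n M).locallyFinite.finite_nonempty_inter_compact hK
    have hB : ∀ p : M, MeasurableSet
        ((extChartAt (𝓡 n) p).symm ⁻¹' K ∩ (extChartAt (𝓡 n) p).target) := by
      intro p
      have h := ((continuousOn_extChartAt_symm (I := 𝓡 n) p).isOpen_inter_preimage
        (isOpen_extChartAt_target p) hK.isClosed.isOpen_compl).measurableSet
      have e : (extChartAt (𝓡 n) p).symm ⁻¹' K ∩ (extChartAt (𝓡 n) p).target =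
          (extChartAt (𝓡 n) p).target \
            ((extChartAt (𝓡 n) p).target ∩ (extChartAt (𝓡 n) p).symm ⁻¹' Kᶜ) := by
        ext y
        simp only [mem_inter_iff, mem_preimage, mem_sdiff, mem_compl_iff]
        tauto
      rw [e]
      exact (isOpen_extChartAt_target p).measurableSet.diff h
    rw [tsum_eq_sum (s := hfin.toFinset)]
    · refine ENNReal.sum_lt_top.mpr fun p _ => ?_
      set K' := extChartAt (𝓡 n) p '' (K ∩ tsupport (chartPartition n M p)) with hK'
      have hsub : K ∩ tsupport (chartPartition n M p) ⊆ (extChartAt (𝓡 n) p).source :=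
        inter_subset_right.trans (chartPartition_subordinate p)
      have hK'c : IsCompact K' := (hK.inter_right (isClosed_tsupport _)).image_of_continuousOn
        ((continuousOn_extChartAt p).mono hsub)
      have hK't : K' ⊆ (extChartAt (𝓡 n) p).target := by
        rintro _ ⟨x, hx, rfl⟩
        exact (extChartAt (𝓡 n) p).map_source (hsub hx)
      rw [← lintegral_inter_add_sdiff _ _ hK'c.measurableSet]
      refine ENNReal.add_lt_top.mpr ⟨?_, ?_⟩
      · refine (lintegral_mono_set inter_subset_right).trans_lt ?_
        exact (((continuousOn_chartDensity hb p).mono hK't).integrableOn_compact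
          hK'c).lintegral_lt_top
      · rw [setLIntegral_eq_zero ((hB p).diff hK'c.measurableSet)]
        · exact ENNReal.zero_lt_top
        · intro y hy
          have h0 : chartPartition n M p ((extChartAt (𝓡 n) p).symm y) = 0 := by
            by_contra h
            exact hy.2 ⟨_, ⟨hy.1.1, subset_tsupport _ h⟩,
              (extChartAt (𝓡 n) p).right_inv hy.1.2⟩
          change ENNReal.ofReal _ = 0
          rw [h0, zero_mul, ENNReal.ofReal_zero]
    · intro p hp
      refine setLIntegral_eq_zero (hB p) fun y hy => ?_
      have h0 : chartPartition n M p ((extChartAt (𝓡 n) p).symm y) = 0 := by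
        by_contra h
        exact hp (hfin.mem_toFinset.mpr ⟨_, h, hy.1⟩)
      change ENNReal.ofReal _ = 0
      rw [h0, zero_mul, ENNReal.ofReal_zero]

/-- Some partition function is positive at a given point of `U`; in its chart the continuous density
exceeds half its value there on a small open set. Positivity is what makes the pairing
non-degenerate. -/
theorem isOpenPosMeasure_volMeasure
    (hb : ∀ p, ContinuousOn (volDensity b p) (extChartAt (𝓡 n) p).target)
    (hb' : ∀ p, ∀ y ∈ (extChartAt (𝓡 n) p).target, 0 < volDensity b p y) :
    (volMeasure b).IsOpenPosMeasure where
  open_pos U hU hne := by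
    obtain ⟨x, hx⟩ := hne
    obtain ⟨p, hp⟩ := (chartPartition n M).exists_pos_of_mem (mem_univ x)
    have hxs : x ∈ (extChartAt (𝓡 n) p).source :=
      chartPartition_subordinate p (subset_tsupport _ hp.ne')
    rw [volMeasure_apply hU.measurableSet]
    refine ne_of_gt (lt_of_lt_of_le ?_ (ENNReal.le_tsum p))
    set F : EuclideanSpace ℝ (Fin n) → ℝ :=
      fun y => chartPartition n M p ((extChartAt (𝓡 n) p).symm y) * volDensity b p y with hF
    set y₀ := extChartAt (𝓡 n) p x with hy₀
    have hy₀t : y₀ ∈ (extChartAt (𝓡 n) p).target := (extChartAt (𝓡 n) p).map_source hxs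
    have hsx : (extChartAt (𝓡 n) p).symm y₀ = x := (extChartAt (𝓡 n) p).left_inv hxs
    have hF0 : 0 < F y₀ := by
      rw [hF]; dsimp only; rw [hsx]; exact mul_pos hp (hb' p _ hy₀t)
    have hO : IsOpen ((extChartAt (𝓡 n) p).target ∩ (extChartAt (𝓡 n) p).symm ⁻¹' U) :=
      (continuousOn_extChartAt_symm p).isOpen_inter_preimage (isOpen_extChartAt_target p) hU
    have hmem : ∀ᶠ y in 𝓝 y₀, y ∈ (extChartAt (𝓡 n) p).target ∩ (extChartAt (𝓡 n) p).symm ⁻¹' U :=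
      hO.mem_nhds ⟨hy₀t, by rwa [mem_preimage, hsx]⟩
    have hlt : ∀ᶠ y in 𝓝 y₀, F y₀ / 2 < F y :=
      ((continuousOn_chartDensity hb p).continuousAt
        ((isOpen_extChartAt_target p).mem_nhds hy₀t)).eventually (Ioi_mem_nhds (half_lt_self hF0))
    obtain ⟨N, hN, hNo, hyN⟩ := eventually_nhds_iff.mp (hmem.and hlt)
    have hNs : N ⊆ (extChartAt (𝓡 n) p).symm ⁻¹' U ∩ (extChartAt (𝓡 n) p).target :=
      fun y hy => ⟨(hN y hy).1.2, (hN y hy).1.1⟩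
    calc (0 : ENNReal) < ENNReal.ofReal (F y₀ / 2) * volume N :=
          ENNReal.mul_pos (ENNReal.ofReal_pos.mpr (half_pos hF0)).ne'
            (hNo.measure_pos _ ⟨y₀, hyN⟩).ne'
      _ = ∫⁻ _ in N, ENNReal.ofReal (F y₀ / 2) := (setLIntegral_const _ _).symm
      _ ≤ ∫⁻ y in N, ENNReal.ofReal (F y) :=
          setLIntegral_mono' hNo.measurableSet fun y hy => ENNReal.ofReal_le_ofReal (hN y hy).2.le
      _ ≤ _ := lintegral_mono_set hNs

end VolumeMeasure

/-! ### The volume density of a Lorentzian metric -/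

namespace Spacetime

section Volume

variable {d : ℕ} {M : Type u} [TopologicalSpace M]
  [ChartedSpace (EuclideanSpace ℝ (Fin (d + 1))) M] [IsManifold (𝓡 (d + 1)) ∞ M]
  (g : Spacetime d M)

theorem continuousOn_volDensity (p : M) :
    ContinuousOn (volDensity (fun x v w => g.metric x v w) p)
      (extChartAt (𝓡 (d + 1)) p).target := by
  have h : ContinuousOn (fun y => Matrix.of fun i j : Fin (d + 1) =>
      g.metric ((extChartAt (𝓡 (d + 1)) p).symm y)
        (chartVec p y (EuclideanSpace.single i (1 : ℝ)))
        (chartVec p y (EuclideanSpace.single j (1 : ℝ)))) (extChartAt (𝓡 (d + 1)) p).target := by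
    refine continuousOn_pi.mpr fun i => continuousOn_pi.mpr fun j => ?_
    exact (g.continuousOn_metric_chartVec p).comp
      (f := fun y => (y, EuclideanSpace.single i (1 : ℝ), EuclideanSpace.single j (1 : ℝ)))
      (by fun_prop) fun y hy => ⟨hy, mem_univ _⟩
  exact (Real.continuous_sqrt.comp (continuous_abs.comp
    (Continuous.matrix_det continuous_id))).comp_continuousOn h

/-- A kernel vector of the Gram matrix would be the coordinates of a tangent vector orthogonal to
the coordinate basis, hence to everything, so it is zero. -/
theorem volDensity_pos (p : M) {y : EuclideanSpace ℝ (Fin (d + 1))}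
    (hy : y ∈ (extChartAt (𝓡 (d + 1)) p).target) :
    0 < volDensity (fun x v w => g.metric x v w) p y := by
  refine Real.sqrt_pos.mpr (abs_pos.mpr fun hdet => ?_)
  obtain ⟨c, hc, hc0⟩ := Matrix.exists_mulVec_eq_zero_iff.mpr hdet
  have hsum : ∀ a : EuclideanSpace ℝ (Fin (d + 1)),
      chartVec p y a = ∑ i, a i • chartVec p y (EuclideanSpace.single i (1 : ℝ)) := by
    intro a
    have e : a = ∑ i, a i • EuclideanSpace.single i (1 : ℝ) := by
      have := (EuclideanSpace.basisFun (Fin (d + 1)) ℝ).sum_repr a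
      simpa using this.symm
    conv_lhs => rw [e]
    rw [chartVec_sum]
    exact Finset.sum_congr rfl fun i _ => chartVec_smul p y _ _
  set u := WithLp.toLp 2 c with hu
  have hrow : ∀ i, g.metric ((extChartAt (𝓡 (d + 1)) p).symm y)
      (chartVec p y (EuclideanSpace.single i (1 : ℝ))) (chartVec p y u) = 0 := by
    intro i
    rw [hsum u, map_sum]
    have := congrFun hc0 i
    simp only [Matrix.mulVec, dotProduct, Matrix.of_apply, Pi.zero_apply] at this
    rw [← this]
    refine Finset.sum_congr rfl fun j _ => ?_
    rw [map_smul, smul_eq_mul, mul_comm]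
    rfl
  have hu0 : chartVec p y u = 0 := by
    refine g.metric_nondegenerate _ _ fun w => ?_
    obtain ⟨a, rfl⟩ := chartVec_surjective p hy w
    rw [hsum a, map_sum, sum_apply]
    refine Finset.sum_eq_zero fun i _ => ?_
    rw [map_smul, smul_apply, hrow i, smul_zero]
  have h0 : chartVec p y (0 : EuclideanSpace ℝ (Fin (d + 1))) = 0 :=
    map_zero (mfderiv (𝓡 (d + 1)) (𝓡 (d + 1)) (extChartAt (𝓡 (d + 1)) p).symm y)
  have := chartVec_injective p hy (hu0.trans h0.symm)
  exact hc (by simpa [hu] using this)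

variable [T2Space M] [SigmaCompactSpace M] [MeasurableSpace M] [BorelSpace M]

instance isFiniteMeasureOnCompacts_vol : IsFiniteMeasureOnCompacts g.vol :=
  isFiniteMeasureOnCompacts_volMeasure g.continuousOn_volDensity

instance isOpenPosMeasure_vol : g.vol.IsOpenPosMeasure :=
  isOpenPosMeasure_volMeasure g.continuousOn_volDensity fun p _ hy => g.volDensity_pos p hy

end Volume

end Spacetime

/-! ### The pairing of sections -/

section Pairing

variable {n : ℕ} {M : Type u} [TopologicalSpace M] [ChartedSpace (EuclideanSpace ℝ (Fin n)) M]
  {V W : HermitianBundle.{u, v} n M}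

theorem continuous_form (s t : Sec V) : Continuous fun x => V.form x (s.1 x) (t.1 x) :=
  (V.form_smooth _ _ s.2 t.2).continuous

theorem form_eq_zero_left {s t : Sec V} {x : M} (h : x ∉ supp s) :
    V.form x (s.1 x) (t.1 x) = 0 := by
  rw [eq_zero_of_notMem_supp h, map_zero, LinearMap.zero_apply]

theorem form_eq_zero_right {s t : Sec V} {x : M} (h : x ∉ supp t) :
    V.form x (s.1 x) (t.1 x) = 0 := by
  rw [eq_zero_of_notMem_supp h, map_zero]

theorem hasCompactSupport_form [T2Space M] {s t : Sec V} {C : Set M} (hC : IsCompact C)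
    (h : supp s ∩ supp t ⊆ C) : HasCompactSupport fun x => V.form x (s.1 x) (t.1 x) := by
  refine HasCompactSupport.intro hC fun x hx => ?_
  by_contra h0
  exact hx (h ⟨by_contra fun hs => h0 (form_eq_zero_left hs),
    by_contra fun ht => h0 (form_eq_zero_right ht)⟩)

variable [MeasurableSpace M] {μ : Measure M}

theorem star_pairing (s t : Sec V) : star (pairing μ s t) = pairing μ t s := by
  unfold pairing
  rw [Complex.star_def, ← integral_conj]
  exact integral_congr_ae (.of_forall fun x => V.form_conj x _ _)

theorem pairing_zero_left (t : Sec V) : pairing μ 0 t = 0 := by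
  simp [pairing, Sec.zero_val]

theorem pairing_zero_right (s : Sec V) : pairing μ s 0 = 0 := by
  simp [pairing, Sec.zero_val]

theorem pairing_smul_right (c : ℂ) (s t : Sec V) : pairing μ s (c • t) = c * pairing μ s t := by
  unfold pairing
  rw [← integral_const_mul]
  exact integral_congr_ae (.of_forall fun x => by simp [Sec.smul_val])

theorem pairing_smul_left (c : ℂ) (s t : Sec V) :
    pairing μ (c • s) t = star c * pairing μ s t := by
  unfold pairing
  rw [← integral_const_mul]
  exact integral_congr_ae (.of_forall fun x => by simp [Sec.smul_val])

variable [T2Space M] [BorelSpace M] [IsFiniteMeasureOnCompacts μ]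

variable (μ) in
theorem integrable_form {s t : Sec V} {C : Set M} (hC : IsCompact C) (h : supp s ∩ supp t ⊆ C) :
    Integrable (fun x => V.form x (s.1 x) (t.1 x)) μ :=
  (continuous_form s t).integrable_of_hasCompactSupport (hasCompactSupport_form hC h)

theorem pairing_add_right {s : Sec V} (hs : s ∈ SecC V) (t t' : Sec V) :
    pairing μ s (t + t') = pairing μ s t + pairing μ s t' := by
  unfold pairing
  rw [← integral_add (integrable_form μ hs inter_subset_left)
    (integrable_form μ hs inter_subset_left)]
  exact integral_congr_ae (.of_forall fun x => by simp [Sec.add_val])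

theorem pairing_add_left {s s' : Sec V} (hs : s ∈ SecC V) (hs' : s' ∈ SecC V) (t : Sec V) :
    pairing μ (s + s') t = pairing μ s t + pairing μ s' t := by
  unfold pairing
  rw [← integral_add (integrable_form μ hs inter_subset_left)
    (integrable_form μ hs' inter_subset_left)]
  exact integral_congr_ae (.of_forall fun x => by simp [Sec.add_val])

theorem pairing_sub_right {s : Sec V} (hs : s ∈ SecC V) (t t' : Sec V) :
    pairing μ s (t - t') = pairing μ s t - pairing μ s t' := by
  rw [sub_eq_add_neg, ← neg_one_smul ℂ t', pairing_add_right hs, pairing_smul_right]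
  ring

variable [SigmaCompactSpace M] [IsManifold (𝓡 n) ∞ M]

omit [BorelSpace M] [IsFiniteMeasureOnCompacts μ] in
-- Formal adjointness is stated for two compactly supported sections. If the supports merely overlap
-- in a compact `C`, both integrands vanish off `C`, and replacing `s`, `t` by `χ s`, `χ t` with `χ
-- = 1` near `C` changes neither.
theorem IsFormalAdjoint.pairing_left {A : Sec V →ₗ[ℂ] Sec W} {A' : Sec W →ₗ[ℂ] Sec V}
    (h : IsFormalAdjoint μ A A') {s : Sec V} {t : Sec W} {C : Set M} (hC : IsCompact C)
    (hst : supp s ∩ supp t ⊆ C) : pairing μ (A s) t = pairing μ s (A' t) := by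
  obtain ⟨χ, L, hL, hχ0, hχ1⟩ := exists_cutoff n hC
  have hs : mulFun χ s ∈ SecC V :=
    mem_SecC_of_subset hL (supp_mulFun_subset_of_eq_zero hL.isClosed hχ0 s)
  have ht : mulFun χ t ∈ SecC W :=
    mem_SecC_of_subset hL (supp_mulFun_subset_of_eq_zero hL.isClosed hχ0 t)
  have hA := h.1.isLocal
  have hA' := h.2.1.isLocal
  have e1 : pairing μ (A s) t = pairing μ (A (mulFun χ s)) (mulFun χ t) := by
    refine integral_congr_ae (.of_forall fun x => ?_)
    dsimp only
    by_cases hx : x ∈ C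
    · rw [(hA.eventuallyEq (mulFun_eventuallyEq (hχ1 x hx) s)).self_of_nhds,
        (mulFun_eventuallyEq (hχ1 x hx) t).self_of_nhds]
    · by_cases hxs : x ∈ supp s
      · have hxt : x ∉ supp t := fun h' => hx (hst ⟨hxs, h'⟩)
        rw [form_eq_zero_right hxt, form_eq_zero_right fun h' => hxt (supp_mulFun_subset χ t h')]
      · rw [form_eq_zero_left fun h' => hxs (hA.supp_subset s h'),
          form_eq_zero_left fun h' => hxs (supp_mulFun_subset χ s (hA.supp_subset _ h'))]
  have e2 : pairing μ s (A' t) = pairing μ (mulFun χ s) (A' (mulFun χ t)) := by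
    refine integral_congr_ae (.of_forall fun x => ?_)
    dsimp only
    by_cases hx : x ∈ C
    · rw [(hA'.eventuallyEq (mulFun_eventuallyEq (hχ1 x hx) t)).self_of_nhds,
        (mulFun_eventuallyEq (hχ1 x hx) s).self_of_nhds]
    · by_cases hxs : x ∈ supp s
      · have hxt : x ∉ supp t := fun h' => hx (hst ⟨hxs, h'⟩)
        rw [form_eq_zero_right fun h' => hxt (hA'.supp_subset t h'),
          form_eq_zero_right fun h' => hxt (supp_mulFun_subset χ t (hA'.supp_subset _ h'))]
      · rw [form_eq_zero_left hxs, form_eq_zero_left fun h' => hxs (supp_mulFun_subset χ s h')]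
  rw [e1, e2, h.2.2 _ hs _ ht]

omit [BorelSpace M] [IsFiniteMeasureOnCompacts μ] in
theorem IsFormalAdjoint.pairing_right {A : Sec V →ₗ[ℂ] Sec W} {A' : Sec W →ₗ[ℂ] Sec V}
    (h : IsFormalAdjoint μ A A') {s : Sec V} {t : Sec W} {C : Set M} (hC : IsCompact C)
    (hst : supp t ∩ supp s ⊆ C) : pairing μ t (A s) = pairing μ (A' t) s := by
  rw [← star_pairing, h.pairing_left hC (inter_comm (supp t) _ ▸ hst), star_pairing]

omit [MeasurableSpace M] [BorelSpace M] [SigmaCompactSpace M] in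
variable (n) in
theorem exists_bump {x : M} {U : Set M} (hU : U ∈ 𝓝 x) : ∃ χ : C^∞⟮𝓡 n, M; ℝ⟯,
    tsupport χ ⊆ U ∧ HasCompactSupport χ ∧ (∀ y, 0 ≤ χ y) ∧ χ x = 1 := by
  obtain ⟨f, -, hf⟩ := (SmoothBumpFunction.nhds_basis_tsupport (I := 𝓡 n) x).mem_iff.mp hU
  exact ⟨⟨f, f.contMDiff⟩, hf, f.hasCompactSupport, fun y => f.nonneg, f.eq_one⟩

omit [MeasurableSpace M] [BorelSpace M] [SigmaCompactSpace M] in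
theorem exists_sec_apply_eq (x : M) (a : V.V x) : ∃ s : Sec V, s.1 x = a := by
  obtain ⟨N, hN, hs⟩ := FiberBundle.exists_contMDiffOn_extend (𝕜 := ℝ) (𝓡 n) V.F (k := ∞) a
  obtain ⟨χ, hχN, -, -, hχ1⟩ := exists_bump n (interior_mem_nhds.mpr hN)
  refine ⟨⟨_, ContMDiffOn.smul_section_of_tsupport χ.contMDiff.contMDiffOn isOpen_interior hχN
    (hs.mono interior_subset)⟩, ?_⟩
  change χ x • FiberBundle.extend V.F a x = a
  rw [hχ1, one_smul, FiberBundle.extend_apply_self]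

variable [μ.IsOpenPosMeasure]

omit [SigmaCompactSpace M] in
-- The fibre forms may be indefinite, so `w` cannot be tested against itself. Instead, if `c =
-- (w(x), a) ≠ 0`, a section with value `a` at `x`, scaled by `star c` and a bump function, gives an
-- integrand with non-negative real part, equal to `|c|²` at `x`.
theorem eq_zero_of_pairing_eq_zero {w : Sec V} (h : ∀ s ∈ SecC V, pairing μ s w = 0) : w = 0 := by
  refine Subtype.ext (funext fun x => V.form_nondeg x _ fun a => ?_)
  obtain ⟨s, hs⟩ := exists_sec_apply_eq x a
  by_contra h0
  set c : ℂ := V.form x (w.1 x) a with hc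
  set f : M → ℝ := fun y => (V.form y ((star c • s).1 y) (w.1 y)).re with hf
  have hcont : Continuous f := Complex.continuous_re.comp (continuous_form _ _)
  have hfx : 0 < f x := by
    have e : V.form x ((star c • s).1 x) (w.1 x) = (Complex.normSq c : ℂ) := by
      rw [← Complex.mul_conj c, Sec.smul_val, Pi.smul_apply, hs, map_smulₛₗ, LinearMap.smul_apply,
        smul_eq_mul, ← V.form_conj]
      simp [hc]
    rw [hf]
    dsimp only
    rw [e, Complex.ofReal_re]
    exact Complex.normSq_pos.mpr h0
  obtain ⟨χ, hχf, hχc, hχ0, hχ1⟩ := exists_bump n (hcont.continuousAt.eventually (Ioi_mem_nhds hfx))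
  have hφ : supp (mulFun χ (star c • s)) ⊆ tsupport χ :=
    supp_mulFun_subset_of_eq_zero (isClosed_tsupport _)
      (fun y hy => image_eq_zero_of_notMem_tsupport hy) _
  have hval : ∀ y, (V.form y ((mulFun χ (star c • s)).1 y) (w.1 y)).re = χ y * f y := by
    intro y
    rw [mulFun_val, map_smulₛₗ, LinearMap.smul_apply, smul_eq_mul, Complex.conj_ofReal,
      Complex.re_ofReal_mul]
  have hpos : 0 < ∫ y, χ y * f y ∂μ := by
    refine Continuous.integral_pos_of_hasCompactSupport_nonneg_nonzero (x := x)
      (χ.contMDiff.continuous.mul hcont) hχc.mul_right (fun y => ?_) ?_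
    · by_cases hy : y ∈ tsupport χ
      · exact mul_nonneg (hχ0 y) (le_of_lt (hχf hy))
      · simp [image_eq_zero_of_notMem_tsupport hy]
    · rw [hχ1, one_mul]; exact hfx.ne'
  have hint := integrable_form μ (s := mulFun χ (star c • s)) (t := w) hχc
    (inter_subset_left.trans hφ)
  have h1 := Complex.reCLM.integral_comp_comm hint
  have h2 : pairing μ (mulFun χ (star c • s)) w = 0 := h _ (mem_SecC_of_subset hχc hφ)
  rw [pairing] at h2
  rw [h2, map_zero] at h1
  refine hpos.ne' ((integral_congr_ae (.of_forall fun y => ?_)).trans h1)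
  exact (hval y).symm

end Pairing

/-! ### Maps and forms on quotients -/

section Quotients

variable {X Y : Type*} [AddCommGroup X] [Module ℂ X] [AddCommGroup Y] [Module ℂ Y]
  {E F : Submodule ℂ X} {E' F' : Submodule ℂ Y}

theorem cls_eq_cls_iff {e e' : X} (he : e ∈ E) (he' : e' ∈ E) :
    cls F e he = cls F e' he' ↔ e - e' ∈ F :=
  Submodule.Quotient.eq _

theorem exists_cls_eq (a : SubQuot E F) : ∃ (e : X) (he : e ∈ E), cls F e he = a := by
  obtain ⟨⟨e, he⟩, rfl⟩ := Submodule.Quotient.mk_surjective (F.submoduleOf E) a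
  exact ⟨e, he, rfl⟩

/-- First isomorphism theorem. The two directions of `hF` give injectivity and well-definedness;
surjectivity is needed only modulo `F'`. -/
theorem exists_isInducedBy (A : X →ₗ[ℂ] Y) (hE : ∀ e ∈ E, A e ∈ E')
    (hF : ∀ e ∈ E, A e ∈ F' ↔ e ∈ F) (hs : ∀ e' ∈ E', ∃ e ∈ E, A e - e' ∈ F') :
    ∃ Φ : SubQuot E F ≃ₗ[ℂ] SubQuot E' F', IsInducedBy A Φ := by
  let f : ↥E →ₗ[ℂ] ↥E' ⧸ F'.submoduleOf E' := (F'.submoduleOf E').mkQ ∘ₗ A.restrict hE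
  have hf : ∀ e : E, f e = cls F' (A e) (hE e e.2) := fun e => rfl
  have hker : F.submoduleOf E = LinearMap.ker f := by
    ext e
    rw [LinearMap.mem_ker]
    refine Iff.trans (hF e e.2).symm ?_
    exact (Submodule.Quotient.mk_eq_zero (F'.submoduleOf E') (x := ⟨A e, hE e e.2⟩)).symm
  have hsurj : Function.Surjective f := by
    intro a
    obtain ⟨e', he', rfl⟩ := exists_cls_eq (E := E') (F := F') a
    obtain ⟨e, he, h⟩ := hs e' he'
    exact ⟨⟨e, he⟩, (cls_eq_cls_iff _ _).mpr h⟩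
  exact ⟨(Submodule.quotEquivOfEq _ _ hker).trans (f.quotKerEquivOfSurjective hsurj),
    fun e he => ⟨hE e he, rfl⟩⟩

theorem exists_sesq_subQuot (B : ↥E →ₗ⋆[ℂ] ↥E →ₗ[ℂ] ℂ)
    (hl : ∀ e e' : E, (e : X) ∈ F → B e e' = 0) (hr : ∀ e e' : E, (e' : X) ∈ F → B e e' = 0) :
    ∃ q : Sesq (SubQuot E F), ∀ (e e' : X) (he : e ∈ E) (he' : e' ∈ E),
      q (cls F e he) (cls F e' he') = B ⟨e, he⟩ ⟨e', he'⟩ := by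
  let f : ↥E →ₗ⋆[ℂ] (↥E ⧸ F.submoduleOf E) →ₗ[ℂ] ℂ :=
    { toFun := fun e => (F.submoduleOf E).liftQ (B e) fun e' he' => hr e e' he'
      map_add' := fun a b => Submodule.linearMap_qext _ (LinearMap.ext fun e =>
        LinearMap.congr_fun (B.map_add a b) e)
      map_smul' := fun c a => Submodule.linearMap_qext _ (LinearMap.ext fun e =>
        LinearMap.congr_fun (B.map_smulₛₗ c a) e) }
  refine ⟨(F.submoduleOf E).liftQ f fun e he => ?_, fun e e' he he' => rfl⟩
  refine Submodule.linearMap_qext _ (LinearMap.ext fun e' => ?_)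
  exact hl e e' he

theorem exists_sesq_transport {U V : Type*} [AddCommGroup U] [Module ℂ U] [AddCommGroup V]
    [Module ℂ V] (q : Sesq U) (Ψ : U ≃ₗ[ℂ] V) :
    ∃ q' : Sesq V, ∀ a b, q' (Ψ a) (Ψ b) = q a b :=
  ⟨LinearMap.mk₂'ₛₗ (starRingEnd ℂ) (RingHom.id ℂ) (fun a b => q (Ψ.symm a) (Ψ.symm b))
    (by simp) (by simp) (by simp) (by simp), by simp⟩

end Quotients

/-! ### The causal propagator of a self-adjoint operator -/

namespace Spacetime

section SelfAdjoint

variable {d : ℕ} {M : Type u} [TopologicalSpace M] [T2Space M] [SigmaCompactSpace M]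
  [ChartedSpace (EuclideanSpace ℝ (Fin (d + 1))) M] [IsManifold (𝓡 (d + 1)) ∞ M]
  [MeasurableSpace M] [BorelSpace M] {g : Spacetime d M}
  {V : HermitianBundle.{u, v} (d + 1) M}

/-- The adjoint of `G^+` is `G^-`: write `s = D G^- s` and move `D` onto `G^+ t`. This is legitimate
because `J^-(supp s) ∩ J^+(supp t)` lies in a compact set, although neither factor is compactly
supported. -/
theorem pairing_causalPropagator (hg : g.GloballyHyperbolic) {D : Sec V →ₗ[ℂ] Sec V}
    (hD : g.GreenHyperbolic D) (hD' : IsFormalAdjoint g.vol D D) (s t : SecC V) :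
    pairing g.vol s.1 (g.causalPropagator hD t) =
      -pairing g.vol (g.causalPropagator hD s) t.1 := by
  obtain ⟨Gp, Gm, hp, hm, e⟩ := exists_causalPropagator_eq hD
  have h1 : pairing g.vol s.1 (Gp t) = pairing g.vol (Gm s) t.1 := by
    obtain ⟨C, hC, h⟩ := hg.exists_compact_superset t.2 s.2
    have := hD'.pairing_left (s := Gm s) (t := Gp t) hC
      ((subset_inter (inter_subset_right.trans (hp.2 t)) (inter_subset_left.trans (hm.2 s))).trans h)
    rwa [hp.1.1, hm.1.1] at this
  have h2 : pairing g.vol s.1 (Gm t) = pairing g.vol (Gp s) t.1 := by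
    obtain ⟨C, hC, h⟩ := hg.exists_compact_superset s.2 t.2
    have := hD'.pairing_left (s := Gp s) (t := Gm t) hC
      ((inter_subset_inter (hp.2 s) (hm.2 t)).trans h)
    rwa [hp.1.1, hm.1.1] at this
  rw [e, LinearMap.sub_apply, LinearMap.sub_apply, pairing_sub_right s.2, h1, h2,
    ← star_pairing t.1 (Gp s - Gm s), pairing_sub_right t.2, star_sub, star_pairing, star_pairing]
  ring

end SelfAdjoint

end Spacetime

/-! ### The solution operator of the Cauchy problem -/

namespace CauchySurface

section Solution

variable {d : ℕ} {M : Type u} [TopologicalSpace M]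
  [ChartedSpace (EuclideanSpace ℝ (Fin (d + 1))) M] [IsManifold (𝓡 (d + 1)) ∞ M]
  {g : Spacetime d M} {S : Type w} [TopologicalSpace S]
  [ChartedSpace (EuclideanSpace ℝ (Fin d)) S] [IsManifold (𝓡 d) ∞ S]
  {C : CauchySurface g S} {V : HermitianBundle.{u, v} (d + 1) M}
  {W : HermitianBundle.{w, v} d S} {D : Sec V →ₗ[ℂ] Sec V} {ρ : Sec V →ₗ[ℂ] Sec W}

theorem solution_mem_kerSC (h : C.IsCauchyHyperbolic D ρ) (φ : SecC W) :
    solution h φ ∈ g.kerSC D := by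
  unfold solution
  exact Subtype.property _

theorem apply_solution (h : C.IsCauchyHyperbolic D ρ) (φ : SecC W) :
    ρ (solution h φ) = φ := by
  -- The equivalence inside `solution` is replaced by an abstract `e`, of which only the values on
  -- solutions are kept.
  have key : ∃ e : g.kerSC D ≃ₗ[ℂ] SecC W, (∀ f, (e f).1 = ρ f.1) ∧
      solution h = (g.kerSC D).subtype ∘ₗ e.symm.toLinearMap := by
    refine ⟨_, ?_, rfl⟩
    exact fun _ => rfl
  obtain ⟨e, he, hs⟩ := key
  have h1 := he (e.symm φ)
  rw [e.apply_symm_apply] at h1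
  rw [hs]
  exact h1.symm

theorem solution_eq (h : C.IsCauchyHyperbolic D ρ) {φ : SecC W} {f : Sec V} (hf : f ∈ g.kerSC D)
    (hφ : ρ f = φ) : solution h φ = f :=
  h.bijOn.injOn (solution_mem_kerSC h φ) hf ((apply_solution h φ).trans hφ.symm)

end Solution

end CauchySurface

/-! ### The subsidiary condition -/

namespace SubsidiaryData

section Spacetime

variable {d : ℕ} {M : Type u} [TopologicalSpace M] [T2Space M] [SigmaCompactSpace M]
  [ChartedSpace (EuclideanSpace ℝ (Fin (d + 1))) M] [IsManifold (𝓡 (d + 1)) ∞ M]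
  [MeasurableSpace M] {g : Spacetime d M} {V₀ V₁ : HermitianBundle.{u, v} (d + 1) M}
  (X : SubsidiaryData g V₀ V₁)

theorem isLocal_P : IsLocal X.P := X.P_selfAdjoint.1.isLocal

theorem isLocal_K : IsLocal X.K := X.K_adjoint.1.isLocal

theorem isLocal_Kadj : IsLocal X.Kadj := X.K_adjoint.2.1.isLocal

theorem isLocal_T : IsLocal X.T := X.T_diffOp.isLocal

theorem isLocal_D : IsLocal X.D := X.isLocal_P.add (X.isLocal_T.comp X.isLocal_Kadj)

theorem isLocal_R : IsLocal X.R := X.isLocal_Kadj.comp X.isLocal_K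

theorem isLocal_Q : IsLocal X.Q := X.isLocal_Kadj.comp X.isLocal_T

theorem D_comp_K : X.D ∘ₗ X.K = X.T ∘ₗ X.R := by
  ext1 s
  have h : X.P (X.K s) = 0 := LinearMap.congr_fun X.PK_eq_zero s
  change X.P (X.K s) + X.T (X.Kadj (X.K s)) = X.T (X.Kadj (X.K s))
  rw [h, zero_add]

/-- The causal propagator `G_R`. -/
noncomputable def GR : SecC V₀ →ₗ[ℂ] Sec V₀ := g.causalPropagator X.green_R

/-- The causal propagator `G_Q`. -/
noncomputable def GQ : SecC V₀ →ₗ[ℂ] Sec V₀ := g.causalPropagator X.green_Q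

/-- `T` on sections of compact support. -/
def TC (h : SecC V₀) : SecC V₁ := ⟨X.T h, X.isLocal_T.mem_SecC h.2⟩

theorem R_GR (h : SecC V₀) : X.Kadj (X.K (X.GR h)) = 0 :=
  Spacetime.apply_causalPropagator X.green_R h

theorem GD_mem_kerSC (s : SecC V₁) : X.GD s ∈ g.kerSC X.D :=
  Spacetime.causalPropagator_mem_kerSC X.green_D s

theorem mem_ranTC {s : SecC V₁} : s ∈ X.ranTC ↔ ∃ h, X.TC h = s := by
  constructor
  · rintro ⟨h, hh, e⟩
    exact ⟨⟨h, hh⟩, Subtype.ext e⟩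
  · rintro ⟨h, rfl⟩
    exact ⟨h, h.2, rfl⟩

theorem mem_ranGDT {f : Sec V₁} : f ∈ X.ranGDT ↔ ∃ h, X.GD (X.TC h) = f := by
  constructor
  · rintro ⟨t, ht, rfl⟩
    obtain ⟨h, rfl⟩ := X.mem_ranTC.mp ht
    exact ⟨h, rfl⟩
  · rintro ⟨h, rfl⟩
    exact ⟨_, X.mem_ranTC.mpr ⟨h, rfl⟩, rfl⟩

theorem mem_ranPC {s : SecC V₁} : s ∈ X.ranPC ↔ ∃ t : SecC V₁, X.P t = s := by
  constructor
  · rintro ⟨t, ht, e⟩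
    exact ⟨⟨t, ht⟩, e⟩
  · rintro ⟨t, e⟩
    exact ⟨t, t.2, e⟩

theorem mem_kerKadjC {s : SecC V₁} : s ∈ X.kerKadjC ↔ X.Kadj s = 0 := Iff.rfl

/-- Intertwining along `D K = T R`: elements of `Ran G_D T` are the pure gauge solutions `K G_R h`.
-/
theorem GD_TC (hg : g.GloballyHyperbolic) (h : SecC V₀) : X.GD (X.TC h) = X.K (X.GR h) :=
  Spacetime.causalPropagator_intertwine hg X.green_R X.green_D X.isLocal_D X.isLocal_K X.isLocal_T
    X.D_comp_K rfl

theorem mem_solSpace {f : Sec V₁} : f ∈ X.solSpace ↔ f ∈ g.kerSC X.D ∧ X.Kadj f = 0 :=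
  ⟨fun h => ⟨h.1, h.2.2⟩, fun h => ⟨h.1, h.1.1, h.2⟩⟩

theorem GD_P_mem (s t : SecC V₁) (hst : X.P t = s) :
    ∃ h, X.GD s = X.GD (X.TC h) := by
  -- Since `P t = D t - T K^* t` and `G_D D t = 0`, the witness is `-K^* t`.
  refine ⟨-⟨X.Kadj t, X.isLocal_Kadj.mem_SecC t.2⟩, ?_⟩
  rw [← sub_eq_zero, ← map_sub]
  refine Spacetime.causalPropagator_apply X.green_D (s := t) ?_
  change X.P t + X.T (X.Kadj t) = s.1 - X.T (-X.Kadj t)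
  rw [map_neg, hst, sub_neg_eq_add]

/-- The right entry is `K G_R h`, and moving `K` to the left produces `K^* s = 0`. -/
theorem pairing_GD_TC_right (hg : g.GloballyHyperbolic) {s : SecC V₁} (hs : s ∈ X.kerKadjC)
    (h : SecC V₀) : pairing g.vol s.1 (X.GD (X.TC h)) = 0 := by
  rw [X.GD_TC hg, X.K_adjoint.pairing_right s.2 inter_subset_left, X.mem_kerKadjC.mp hs,
    pairing_zero_left]

theorem TC_zero : X.TC 0 = 0 := Subtype.ext (map_zero X.T)

theorem pairing_GD_left_of_eq (hTK : X.T = X.K) {h : SecC V₀} {s : SecC V₁}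
    (hs : X.Kadj (X.GD s) = 0) : pairing g.vol (X.TC h).1 (X.GD s) = 0 := by
  have e : (X.TC h).1 = X.K h := LinearMap.congr_fun hTK h.1
  rw [e, X.K_adjoint.pairing_left h.2 inter_subset_left, hs, pairing_zero_right]

theorem ranGDT_le (hg : g.GloballyHyperbolic) : X.ranGDT ≤ X.solSpace := by
  intro f hf
  obtain ⟨h, rfl⟩ := X.mem_ranGDT.mp hf
  rw [mem_solSpace]
  refine ⟨X.GD_mem_kerSC _, ?_⟩
  rw [X.GD_TC hg, X.R_GR]

theorem pairing_GD_ranPC_right (hg : g.GloballyHyperbolic) {s t : SecC V₁} (hs : s ∈ X.kerKadjC)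
    (ht : t ∈ X.ranPC) : pairing g.vol s.1 (X.GD t) = 0 := by
  obtain ⟨t', ht'⟩ := X.mem_ranPC.mp ht
  obtain ⟨h, hh⟩ := X.GD_P_mem _ _ ht'
  rw [hh, X.pairing_GD_TC_right hg hs]

variable [BorelSpace M]

/-- This is the adjoint of `P K = 0`, tested against compactly supported sections; it rests on
non-degeneracy of the pairing. -/
theorem Kadj_P (s : Sec V₁) : X.Kadj (X.P s) = 0 := by
  refine eq_zero_of_pairing_eq_zero (μ := g.vol) fun t ht => ?_
  rw [← X.K_adjoint.pairing_left ht inter_subset_left,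
    ← X.P_selfAdjoint.pairing_left (X.isLocal_K.mem_SecC ht) inter_subset_left]
  have h : X.P (X.K t) = 0 := LinearMap.congr_fun X.PK_eq_zero t
  rw [h, pairing_zero_left]

theorem Kadj_comp_D : X.Q ∘ₗ X.Kadj = X.Kadj ∘ₗ X.D := by
  ext1 s
  change X.Kadj (X.T (X.Kadj s)) = X.Kadj (X.P s + X.T (X.Kadj s))
  rw [map_add, X.Kadj_P, zero_add]

theorem ranPC_le : X.ranPC ≤ X.kerKadjC := by
  intro s hs
  obtain ⟨t, ht⟩ := X.mem_ranPC.mp hs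
  rw [mem_kerKadjC, ← ht, X.Kadj_P]

theorem Kadj_GD (hg : g.GloballyHyperbolic) {s : SecC V₁} {t : SecC V₀} (h : X.Kadj s = t) :
    X.Kadj (X.GD s) = X.GQ t :=
  (Spacetime.causalPropagator_intertwine hg X.green_D X.green_Q X.isLocal_Q X.isLocal_Kadj
    X.isLocal_Kadj X.Kadj_comp_D h).symm

theorem Kadj_GD_eq_zero (hg : g.GloballyHyperbolic) {s : SecC V₁} (hs : s ∈ X.kerKadjC) :
    X.Kadj (X.GD s) = 0 := by
  rw [X.Kadj_GD hg (t := 0) hs, map_zero]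

theorem GD_mem_solSpace (hg : g.GloballyHyperbolic) {s : SecC V₁} (hs : s ∈ X.kerKadjC) :
    X.GD s ∈ X.solSpace :=
  X.mem_solSpace.mpr ⟨X.GD_mem_kerSC s, X.Kadj_GD_eq_zero hg hs⟩

/-- Every solution satisfying the subsidiary condition is, up to `Ran G_D T`, the image under
`G_D` of a section in `Ker K^*`. -/
theorem exists_GD_add_TC (hg : g.GloballyHyperbolic) {f : Sec V₁} (hf : f ∈ X.solSpace) :
    ∃ s ∈ X.kerKadjC, ∃ h, X.GD (s + X.TC h) = f := by
  obtain ⟨hf, hKf⟩ := X.mem_solSpace.mp hf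
  obtain ⟨u, rfl⟩ := Spacetime.exists_causalPropagator_eq_of_mem_kerSC hg X.green_D X.isLocal_D hf
  -- Here `G_Q K^* u = K^* G_D u = 0`, so `K^* u = Q h = K^* T h`, and subtracting `T h` from `u`
  -- enforces the subsidiary condition.
  obtain ⟨h, hh⟩ := Spacetime.exists_of_causalPropagator_eq_zero hg X.green_Q
    (s := ⟨X.Kadj u, X.isLocal_Kadj.mem_SecC u.2⟩)
    ((X.Kadj_GD hg (t := ⟨X.Kadj u, X.isLocal_Kadj.mem_SecC u.2⟩) rfl).symm.trans hKf)
  refine ⟨u - X.TC h, ?_, h, ?_⟩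
  · rw [mem_kerKadjC]
    have hh' : X.Kadj (X.T h) = X.Kadj u := hh
    change X.Kadj (u.1 - X.T h) = 0
    rw [map_sub, hh', sub_self]
  · rw [sub_add_cancel]; rfl

/-- Exactness for `D` gives `s - T h = P t + T K^* t`. Applying `K^*` leaves `Q (K^* t + h) = 0`,
and `Q` is injective on compactly supported sections, so the `T` terms cancel and `s = P t`. -/
theorem mem_ranPC_of_GD_mem (hg : g.GloballyHyperbolic) {s : SecC V₁} (hs : s ∈ X.kerKadjC)
    (h : X.GD s ∈ X.ranGDT) : s ∈ X.ranPC := by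
  obtain ⟨h, hh⟩ := X.mem_ranGDT.mp h
  obtain ⟨t, ht⟩ := Spacetime.exists_of_causalPropagator_eq_zero hg X.green_D (s := s - X.TC h)
    (by rw [map_sub]; exact sub_eq_zero.mpr hh.symm)
  have ht : X.P t + X.T (X.Kadj t) = s.1 - X.T h := ht
  have hQ : X.Kadj (X.T (X.Kadj t + h.1)) = 0 := by
    have h1 := congrArg X.Kadj ht
    rw [map_add, X.Kadj_P, zero_add, map_sub, X.mem_kerKadjC.mp hs, zero_sub] at h1
    rw [map_add, map_add, h1, neg_add_cancel]
  -- A propagator is a left inverse of `Q` on `Γ_c`, whence the injectivity.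
  have h0 : X.Kadj t + h.1 = 0 := by
    obtain ⟨Gp, -, hp, -⟩ := Spacetime.exists_causalPropagator_eq X.green_Q
    have := hp.1.2 ⟨X.Kadj t + h.1, (SecC V₀).add_mem (X.isLocal_Kadj.mem_SecC t.2) h.2⟩ 0 hQ
    rw [map_zero] at this
    exact this.symm
  refine X.mem_ranPC.mpr ⟨t, ?_⟩
  rw [eq_neg_of_add_eq_zero_left h0, map_neg, ← sub_eq_add_neg] at ht
  exact sub_left_injective ht

/-- `P` moves to the right, where `P G_D t = -T K^* G_D t = 0`. -/
theorem pairing_GD_ranPC_left (hg : g.GloballyHyperbolic) {s t : SecC V₁} (hs : s ∈ X.ranPC)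
    (ht : t ∈ X.kerKadjC) : pairing g.vol s.1 (X.GD t) = 0 := by
  obtain ⟨s', hs'⟩ := X.mem_ranPC.mp hs
  have h := (X.GD_mem_kerSC t).2
  have h : X.P (X.GD t) + X.T (X.Kadj (X.GD t)) = 0 := h
  rw [X.Kadj_GD_eq_zero hg ht, map_zero, add_zero] at h
  rw [← hs', X.P_selfAdjoint.pairing_left s'.2 inter_subset_left, h, pairing_zero_right]

theorem exists_qP (hg : g.GloballyHyperbolic) : ∃ q : Sesq X.VP, X.IsqP q := by
  let B : ↥X.kerKadjC →ₗ⋆[ℂ] ↥X.kerKadjC →ₗ[ℂ] ℂ :=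
    LinearMap.mk₂'ₛₗ (starRingEnd ℂ) (RingHom.id ℂ)
      (fun s t => Complex.I⁻¹ * pairing g.vol s.1.1 (X.GD t.1))
      (fun s s' t => by
        have := pairing_add_left (μ := g.vol) s.1.2 s'.1.2 (X.GD t.1)
        exact (congrArg (Complex.I⁻¹ * ·) this).trans (mul_add _ _ _))
      (fun c s t => by
        have := pairing_smul_left (μ := g.vol) c s.1.1 (X.GD t.1)
        exact (congrArg (Complex.I⁻¹ * ·) this).trans (mul_left_comm _ _ _))
      (fun s t t' => by
        have := pairing_add_right (μ := g.vol) s.1.2 (X.GD t.1) (X.GD t'.1)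
        rw [← map_add] at this
        exact (congrArg (Complex.I⁻¹ * ·) this).trans (mul_add _ _ _))
      (fun c s t => by
        have := pairing_smul_right (μ := g.vol) c s.1.1 (X.GD t.1)
        rw [← map_smul] at this
        exact (congrArg (Complex.I⁻¹ * ·) this).trans (mul_left_comm _ _ _))
  have hB : ∀ s t, B s t = Complex.I⁻¹ * pairing g.vol s.1.1 (X.GD t.1) := fun s t => rfl
  obtain ⟨q, hq⟩ := exists_sesq_subQuot (F := X.ranPC) B
    (fun s t h => by rw [hB, X.pairing_GD_ranPC_left hg h t.2, mul_zero])
    (fun s t h => by rw [hB, X.pairing_GD_ranPC_right hg s.2 h, mul_zero])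
  exact ⟨q, fun s t hs ht => hq s t hs ht⟩

end Spacetime

/-! ### Cauchy data, constraints and the form on the surface -/

section Surface

variable {d : ℕ} {M : Type u} [TopologicalSpace M] [T2Space M] [SigmaCompactSpace M]
  [ChartedSpace (EuclideanSpace ℝ (Fin (d + 1))) M] [IsManifold (𝓡 (d + 1)) ∞ M]
  [MeasurableSpace M] [BorelSpace M] {g : Spacetime d M}
  {V₀ V₁ : HermitianBundle.{u, v} (d + 1) M} (X : SubsidiaryData g V₀ V₁)
  {S : Type w} [TopologicalSpace S] [ChartedSpace (EuclideanSpace ℝ (Fin d)) S]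
  [IsManifold (𝓡 d) ∞ S] {C : CauchySurface g S} {WR WD WQ : HermitianBundle.{w, v} d S}
  {ρR : Sec V₀ →ₗ[ℂ] Sec WR} {ρD : Sec V₁ →ₗ[ℂ] Sec WD} {ρQ : Sec V₀ →ₗ[ℂ] Sec WQ}
  (hR : C.IsCauchyHyperbolic X.R ρR) (hD : C.IsCauchyHyperbolic X.D ρD)
  (hQ : C.IsCauchyHyperbolic X.Q ρQ)

include hQ in
-- For a solution `f` of `D`, the section `K^* f` solves `Q` because `Q K^* = K^* D`. Injectivity of
-- `ρ_Q` then turns the surface constraint `ρ_Q K^* f = 0` into `K^* f = 0` on all of `M`.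
theorem mem_kerKSigmaDagger {φ : Sec WD} :
    φ ∈ X.kerKSigmaDagger hD ρQ ↔ ∃ f ∈ X.solSpace, ρD f = φ := by
  constructor
  · rintro ⟨φ, hφ, rfl⟩
    have hU := CauchySurface.solution_mem_kerSC hD φ
    refine ⟨CauchySurface.solution hD φ, X.mem_solSpace.mpr ⟨hU, ?_⟩,
      CauchySurface.apply_solution hD φ⟩
    refine hQ.bijOn.injOn ⟨Spacetime.map_mem_SecSC X.isLocal_Kadj hU.1, ?_⟩ (Submodule.zero_mem _)
      ?_
    · have h := LinearMap.congr_fun X.Kadj_comp_D (CauchySurface.solution hD φ)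
      have hU2 : X.D (CauchySurface.solution hD φ) = 0 := hU.2
      exact h.trans ((congrArg X.Kadj hU2).trans (map_zero _))
    · exact Eq.trans hφ (map_zero _).symm
  · rintro ⟨f, hf, rfl⟩
    obtain ⟨hf, hKf⟩ := X.mem_solSpace.mp hf
    refine ⟨⟨ρD f, hD.bijOn.mapsTo hf⟩, ?_, rfl⟩
    change ρQ (X.Kadj (CauchySurface.solution hD _)) = 0
    rw [CauchySurface.solution_eq hD hf rfl, hKf, map_zero]

omit [BorelSpace M] in
-- The solutions `U_R χ` are exactly the `G_R h` with `h` of compact support, and `K G_R h = G_D T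
-- h`.
theorem mem_ranKSigma (hg : g.GloballyHyperbolic) {φ : Sec WD} :
    φ ∈ X.ranKSigma hR ρD ↔ ∃ f ∈ X.ranGDT, ρD f = φ := by
  constructor
  · rintro ⟨χ, rfl⟩
    obtain ⟨h, hh⟩ := Spacetime.exists_causalPropagator_eq_of_mem_kerSC hg X.green_R X.isLocal_R
      (CauchySurface.solution_mem_kerSC hR χ)
    refine ⟨_, X.mem_ranGDT.mpr ⟨h, rfl⟩, ?_⟩
    rw [X.GD_TC hg]
    exact congrArg (fun f => ρD (X.K f)) hh
  · rintro ⟨f, hf, rfl⟩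
    obtain ⟨h, rfl⟩ := X.mem_ranGDT.mp hf
    have hm : X.GR h ∈ g.kerSC X.R := Spacetime.causalPropagator_mem_kerSC X.green_R h
    refine ⟨⟨ρR (X.GR h), hR.bijOn.mapsTo hm⟩, ?_⟩
    rw [X.GD_TC hg]
    exact congrArg (fun f => ρD (X.K f)) (CauchySurface.solution_eq hR hm rfl)

include hQ in
theorem ranKSigma_le (hg : g.GloballyHyperbolic) :
    X.ranKSigma hR ρD ≤ X.kerKSigmaDagger hD ρQ := by
  intro φ hφ
  obtain ⟨f, hf, e⟩ := (X.mem_ranKSigma hR hg).mp hφ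
  exact (X.mem_kerKSigmaDagger hD hQ).mpr ⟨f, X.ranGDT_le hg hf, e⟩

omit [BorelSpace M] in
include hD in
theorem apply_mem_ranKSigma_iff (hg : g.GloballyHyperbolic) {f : Sec V₁} (hf : f ∈ X.solSpace) :
    ρD f ∈ X.ranKSigma hR ρD ↔ f ∈ X.ranGDT := by
  rw [X.mem_ranKSigma hR hg]
  constructor
  · rintro ⟨f', hf', e⟩
    rwa [← hD.bijOn.injOn (X.ranGDT_le hg hf').1 hf.1 e]
  · exact fun h => ⟨f, h, rfl⟩

include hQ in
theorem exists_inducedBy_ρD (hg : g.GloballyHyperbolic) :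
    ∃ Φ : SubQuot X.solSpace X.ranGDT ≃ₗ[ℂ] X.VSigma hR hD ρQ, IsInducedBy ρD Φ :=
  exists_isInducedBy ρD (fun f hf => (X.mem_kerKSigmaDagger hD hQ).mpr ⟨f, hf, rfl⟩)
    (fun _ hf => X.apply_mem_ranKSigma_iff hR hD hg hf) fun φ hφ => by
      obtain ⟨f, hf, e⟩ := (X.mem_kerKSigmaDagger hD hQ).mp hφ
      exact ⟨f, hf, by rw [e, sub_self]; exact Submodule.zero_mem _⟩

include hQ in
theorem exists_inducedBy_ρD_GD (hg : g.GloballyHyperbolic) :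
    ∃ Ψ : X.VP ≃ₗ[ℂ] X.VSigma hR hD ρQ, IsInducedBy (ρD ∘ₗ X.GD) Ψ := by
  refine exists_isInducedBy (ρD ∘ₗ X.GD)
    (fun s hs => (X.mem_kerKSigmaDagger hD hQ).mpr ⟨_, X.GD_mem_solSpace hg hs, rfl⟩)
    (fun s hs => (X.apply_mem_ranKSigma_iff hR hD hg (X.GD_mem_solSpace hg hs)).trans
      ⟨X.mem_ranPC_of_GD_mem hg hs, fun h => ?_⟩) fun φ hφ => ?_
  · obtain ⟨t, ht⟩ := X.mem_ranPC.mp h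
    obtain ⟨k, hk⟩ := X.GD_P_mem _ _ ht
    exact X.mem_ranGDT.mpr ⟨k, hk.symm⟩
  · obtain ⟨f, hf, rfl⟩ := (X.mem_kerKSigmaDagger hD hQ).mp hφ
    obtain ⟨s, hs, h, rfl⟩ := X.exists_GD_add_TC hg hf
    -- The data of `G_D s` and of `G_D (s + T h)` differ by those of `-G_D T h`, which are pure
    -- gauge.
    refine ⟨s, hs, (X.mem_ranKSigma hR hg).mpr ⟨_, Submodule.neg_mem _
      (X.mem_ranGDT.mpr ⟨h, rfl⟩), ?_⟩⟩
    rw [LinearMap.comp_apply, ← map_sub, ← map_sub, sub_add_cancel_left, map_neg, map_neg, map_neg]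

variable [T2Space S] [SigmaCompactSpace S] [MeasurableSpace S]

include hQ in
/-- For representatives `φ = ρ_D G_D (s + T h)` and `ψ = ρ_D G_D (t + T k)`, with `s` and `t` in
`Ker K^*`, the formula for `q_ΣP` is equivalent to `(T h | G_D (t + T k)) = 0`. -/
theorem formulaAt_iff (hg : g.GloballyHyperbolic) {qP : Sesq X.VP} (hqP : X.IsqP qP)
    {Ψ : X.VP ≃ₗ[ℂ] X.VSigma hR hD ρQ} (hΨ : IsInducedBy (ρD ∘ₗ X.GD) Ψ)
    {qS : Sesq (X.VSigma hR hD ρQ)} (hqS : ∀ a b, qS (Ψ a) (Ψ b) = qP a b)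
    {GS : SecC WD →ₗ[ℂ] SecC WD} (hGS : X.IsSurfacePropagator C ρD GS) {s t : SecC V₁}
    (hs : s ∈ X.kerKadjC) (ht : t ∈ X.kerKadjC) {h k : SecC V₀} {φ ψ : SecC WD}
    (hφ : ρD (X.GD (s + X.TC h)) = φ) (hψ : ρD (X.GD (t + X.TC k)) = ψ) :
    X.FormulaAt qS GS φ ψ ↔ pairing g.vol (X.TC h).1 (X.GD t) +
      pairing g.vol (X.TC h).1 (X.GD (X.TC k)) = 0 := by
  have hmem : ∀ {s : SecC V₁} {h : SecC V₀}, s ∈ X.kerKadjC →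
      X.GD (s + X.TC h) ∈ X.solSpace := fun {s h} hs => by
    rw [map_add]
    exact Submodule.add_mem _ (X.GD_mem_solSpace hg hs)
      (X.ranGDT_le hg (X.mem_ranGDT.mpr ⟨h, rfl⟩))
  -- The summand `T h` alters the data only by an element of `Ran K_Σ`, so the class depends on `s`
  -- alone.
  have hcls : ∀ {s : SecC V₁} {h : SecC V₀} {φ : Sec WD} (hs : s ∈ X.kerKadjC)
      (_ : ρD (X.GD (s + X.TC h)) = φ) (hφ' : φ ∈ X.kerKSigmaDagger hD ρQ),
      cls (X.ranKSigma hR ρD) φ hφ' = Ψ (cls X.ranPC s hs) := by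
    intro s h φ hs hφ hφ'
    obtain ⟨h1, h2⟩ := hΨ s hs
    rw [h2, cls_eq_cls_iff, ← hφ, LinearMap.comp_apply, ← map_sub, ← map_sub, add_sub_cancel_left]
    exact (X.mem_ranKSigma hR hg).mpr ⟨_, X.mem_ranGDT.mpr ⟨h, rfl⟩, rfl⟩
  have hφ' : φ.1 ∈ X.kerKSigmaDagger hD ρQ :=
    (X.mem_kerKSigmaDagger hD hQ).mpr ⟨_, hmem hs, hφ⟩
  have hψ' : ψ.1 ∈ X.kerKSigmaDagger hD ρQ :=
    (X.mem_kerKSigmaDagger hD hQ).mpr ⟨_, hmem ht, hψ⟩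
  -- The surface pairing is evaluated on `M` through `hGS`; of the three extra terms, `(s|G_D T k)`
  -- vanishes because `K^* s = 0`.
  have hexp : pairing g.vol (s + X.TC h).1 (X.GD (t + X.TC k)) = pairing g.vol s.1 (X.GD t) +
      (pairing g.vol (X.TC h).1 (X.GD t) + pairing g.vol (X.TC h).1 (X.GD (X.TC k))) := by
    rw [map_add, pairing_add_right (s + X.TC h).2]
    have e := fun f => pairing_add_left (μ := g.vol) s.2 (X.TC h).2 f
    refine (congrArg₂ (· + ·) (e _) (e _)).trans ?_
    rw [X.pairing_GD_TC_right hg hs]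
    ring
  have hq : ∀ (h1 : φ.1 ∈ X.kerKSigmaDagger hD ρQ) (h2 : ψ.1 ∈ X.kerKSigmaDagger hD ρQ),
      qS (cls (X.ranKSigma hR ρD) φ h1) (cls (X.ranKSigma hR ρD) ψ h2) =
        Complex.I⁻¹ * pairing g.vol s.1 (X.GD t) := fun h1 h2 => by
    rw [hcls hs hφ, hcls ht hψ, hqS, hqP]
  have hI : Complex.I⁻¹ ≠ 0 := inv_ne_zero Complex.I_ne_zero
  constructor
  · intro hF
    have := hF hφ' hψ'
    rw [hq, ← hGS _ _ _ _ hφ hψ, hexp] at this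
    exact left_eq_add.mp (mul_left_cancel₀ hI this)
  · intro h0 h1 h2
    rw [hq, ← hGS _ _ _ _ hφ hψ, hexp, h0, add_zero]

end Surface

end SubsidiaryData

end GaugeTheory

theorem mainTheorem8 {d : ℕ}
    {M : Type u} [TopologicalSpace M] [T2Space M] [SigmaCompactSpace M]
    [ChartedSpace (EuclideanSpace ℝ (Fin (d + 1))) M] [IsManifold (𝓡 (d + 1)) ∞ M]
    [MeasurableSpace M] [BorelSpace M]
    {S : Type w} [TopologicalSpace S] [T2Space S] [SigmaCompactSpace S]
    [ChartedSpace (EuclideanSpace ℝ (Fin d)) S] [IsManifold (𝓡 d) ∞ S]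
    [MeasurableSpace S] [BorelSpace S]
    (g : GaugeTheory.Spacetime d M) (hg : g.GloballyHyperbolic)
    (C : GaugeTheory.CauchySurface g S)
    {V₀ V₁ : GaugeTheory.HermitianBundle.{u, v} (d + 1) M}
    (X : GaugeTheory.SubsidiaryData g V₀ V₁)
    {WR WD WQ : GaugeTheory.HermitianBundle.{w, v} d S}
    {ρR : GaugeTheory.Sec V₀ →ₗ[ℂ] GaugeTheory.Sec WR}
    {ρD : GaugeTheory.Sec V₁ →ₗ[ℂ] GaugeTheory.Sec WD}
    {ρQ : GaugeTheory.Sec V₀ →ₗ[ℂ] GaugeTheory.Sec WQ}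
    (hR : C.IsCauchyHyperbolic X.R ρR) (hD : C.IsCauchyHyperbolic X.D ρD)
    (hQ : C.IsCauchyHyperbolic X.Q ρQ) :
    -- `[ρ_D]` is a well defined bijection of the quotient of solutions onto `V_ΣP`
    (X.ranGDT ≤ X.solSpace ∧ X.ranKSigma hR ρD ≤ X.kerKSigmaDagger hD ρQ ∧
      ∃ Φ : GaugeTheory.SubQuot X.solSpace X.ranGDT ≃ₗ[ℂ] X.VSigma hR hD ρQ,
        GaugeTheory.IsInducedBy ρD Φ) ∧
    -- `q_P` is well defined on `V_P`, and `[ρ_D G_D]` is an isomorphism of phase spaces from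
    -- `(V_P, q_P)` onto `(V_ΣP, q_ΣP)`
    X.ranPC ≤ X.kerKadjC ∧
    ∃ (qP : GaugeTheory.Sesq X.VP) (Ψ : X.VP ≃ₗ[ℂ] X.VSigma hR hD ρQ)
      (qS : GaugeTheory.Sesq (X.VSigma hR hD ρQ)),
      X.IsqP qP ∧ GaugeTheory.IsInducedBy (ρD ∘ₗ X.GD) Ψ ∧ (∀ a b, qS (Ψ a) (Ψ b) = qP a b) ∧
      -- description of `q_ΣP` through the operator `G_DΣ`
      ∀ GS : GaugeTheory.SecC WD →ₗ[ℂ] GaugeTheory.SecC WD, X.IsSurfacePropagator C ρD GS →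
        -- if `T = K`: the formula holds for all representatives
        (X.T = X.K → ∀ φ ψ, X.FormulaAt qS GS φ ψ) ∧
        -- if `D = D^*`: the formula holds if the first representative lies in
        -- `ρ_D G_D Ker K^*`, and it holds for all representatives iff `Ran T` is isotropic
        (GaugeTheory.IsFormalAdjoint g.vol X.D X.D →
          (∀ s ∈ X.kerKadjC, ∀ φ ψ : GaugeTheory.SecC WD,
            ρD (X.GD s) = φ → X.FormulaAt qS GS φ ψ) ∧
          ((∀ φ ψ, X.FormulaAt qS GS φ ψ) ↔
            ∀ s ∈ X.ranTC, ∀ t ∈ X.ranTC,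
              GaugeTheory.pairing g.vol (s : GaugeTheory.Sec V₁) (X.GD t) = 0)) := by
  obtain ⟨qP, hqP⟩ := X.exists_qP hg
  obtain ⟨Ψ, hΨ⟩ := X.exists_inducedBy_ρD_GD hR hD hQ hg
  obtain ⟨qS, hqS⟩ := GaugeTheory.exists_sesq_transport qP Ψ
  refine ⟨⟨X.ranGDT_le hg, X.ranKSigma_le hR hD hQ hg, X.exists_inducedBy_ρD hR hD hQ hg⟩,
    X.ranPC_le, qP, Ψ, qS, hqP, hΨ, hqS, fun GS hGS => ?_⟩
  have hrep : ∀ φ : GaugeTheory.SecC WD, (φ : GaugeTheory.Sec WD) ∈ X.kerKSigmaDagger hD ρQ →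
      ∃ s ∈ X.kerKadjC, ∃ h, ρD (X.GD (s + X.TC h)) = φ := fun φ hφ => by
    obtain ⟨f, hf, e⟩ := (X.mem_kerKSigmaDagger hD hQ).mp hφ
    obtain ⟨s, hs, h, rfl⟩ := X.exists_GD_add_TC hg hf
    exact ⟨s, hs, h, e⟩
  refine ⟨fun hTK φ ψ hφ hψ => ?_, fun hDD => ⟨fun s hs φ ψ hφs hφ hψ => ?_, fun H => ?_,
    fun H φ ψ hφ hψ => ?_⟩⟩
  · obtain ⟨s, hs, h, e⟩ := hrep φ hφ
    obtain ⟨t, ht, k, e'⟩ := hrep ψ hψ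
    refine (X.formulaAt_iff hR hD hQ hg hqP hΨ hqS hGS hs ht e e').mpr ?_ hφ hψ
    -- For `T = K` both error terms have the form `(h|K^* G_D ·)`. The first vanishes because `K^* t
    -- = 0`, the second because `K^* G_D T k = R G_R k = 0`.
    rw [X.pairing_GD_left_of_eq hTK (X.Kadj_GD_eq_zero hg ht), X.pairing_GD_left_of_eq hTK, add_zero]
    rw [X.GD_TC hg, X.R_GR]
  · obtain ⟨t, ht, k, e'⟩ := hrep ψ hψ
    refine (X.formulaAt_iff hR hD hQ hg hqP hΨ hqS hGS (h := 0) hs ht ?_ e').mpr ?_ hφ hψ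
    · rw [X.TC_zero, add_zero, hφs]
    · rw [X.TC_zero]
      exact (congrArg₂ (· + ·) (GaugeTheory.pairing_zero_left _)
        (GaugeTheory.pairing_zero_left _)).trans (add_zero 0)
  · intro s hs t ht
    obtain ⟨h, rfl⟩ := X.mem_ranTC.mp hs
    obtain ⟨k, rfl⟩ := X.mem_ranTC.mp ht
    -- With `s = t = 0` both data are pure gauge, and the error term reduces to `(T h|G_D T k)`.
    have h0 := (X.formulaAt_iff hR hD hQ hg hqP hΨ hqS hGS (h := h) (k := k)
      X.kerKadjC.zero_mem X.kerKadjC.zero_mem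
      (φ := ⟨_, hD.bijOn.mapsTo (X.GD_mem_kerSC _)⟩) (ψ := ⟨_, hD.bijOn.mapsTo (X.GD_mem_kerSC _)⟩)
      rfl rfl).mp (H _ _)
    rwa [map_zero, GaugeTheory.pairing_zero_right, zero_add] at h0
  · obtain ⟨s, hs, h, e⟩ := hrep φ hφ
    obtain ⟨t, ht, k, e'⟩ := hrep ψ hψ
    refine (X.formulaAt_iff hR hD hQ hg hqP hΨ hqS hGS hs ht e e').mpr ?_ hφ hψ
    rw [H _ (X.mem_ranTC.mpr ⟨h, rfl⟩) _ (X.mem_ranTC.mpr ⟨k, rfl⟩), add_zero]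
    -- The remaining term `(T h|G_D t)` is minus the conjugate of `(t|G_D T h)`, which vanishes as
    -- `K^* t = 0`.
    refine (GaugeTheory.Spacetime.pairing_causalPropagator hg X.green_D hDD (X.TC h) t).trans ?_
    rw [← GaugeTheory.star_pairing]
    have h0 := X.pairing_GD_TC_right hg ht h
    rw [GaugeTheory.SubsidiaryData.GD] at h0
    rw [h0, star_zero, neg_zero]
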